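/- Let $d,\alpha\ge 1$ be integers and $\rho(x)=(2\pi)^{-d/2}e^{-|x|^2/2}$ on $\mathbb{R}^d$. Let $H_\rho^\alpha$ be the space of all real-valued functions $f$ on $\mathbb{R}^d$ whose weak derivatives $D^{\mathbf r}f$ exist and satisfy $\|D^{\mathbf r}f\|_{L^2_\rho}^2=\int_{\mathbb{R}^d}|D^{\mathbf r}f|^2\rho\,dx<\infty$ for all $\mathbf r\in\{0,\dots,\alpha\}^d$, with norm $\|f\|_{H_\rho^\alpha}=\bigl(\sum_{|\mathbf r|_\infty\le\alpha}\|D^{\mathbf r}f\|_{L^2_\rho}^2\bigr)^{1/2}$. Put $\phi(t)=-\cot(\pi t)$ for $t\in(0,1)$ and $\Psi_{\cot}(t)=(\phi(t_1),\dots,\phi(t_d))$, and for $f\in H_\rho^\alpha$ define $$g(t)=f(\Psi_{\cot}(t))\,\rho(\Psi_{\cot}(t))\prod_{k=1}^d\phi'(t_k),\qquad t\in(0,1)^d.$$ Then there is a constant $C>0$, depending only on $d$ and $\alpha$, such that for all $f\in H_\rho^\alpha$ and all $\mathbf r\in\{0,\dots,\alpha\}^d$ the weak derivative $D^{\mathbf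 r}g$ on $(0,1)^d$ exists, lies in $L^2([0,1]^d)$, satisfies $$\|D^{\mathbf r}g\|_{L^2([0,1]^d)}\le C\,\|f\|_{H_\rho^\alpha},$$ and has a representative, again denoted by $D^{\mathbf r}g$, with the following properties. (a) For every $\ell\in\{1,\dots,d\}$ with $r_\ell\le\alpha-1$ and almost every $(t_1,\dots,t_{\ell-1},t_{\ell+1},\dots,t_d)\in(0,1)^{d-1}$, the map $t_\ell\mapsto D^{\mathbf r}g(t)$ is continuous on $(0,1)$ and $$\lim_{t_\ell\to0+}D^{\mathbf r}g(t)=\lim_{t_\ell\to1-}D^{\mathbf r}g(t)=0,$$ so that its extension by zero is continuous on $[0,1]$. (b) If $\mathbf r\in\{0,\dots,\alpha-1\}^d$, then the representative is continuous on $(0,1)^d$, and the conclusion of (a) holds for every $\ell$ and every $(t_1,\dots,t_{\ell-1},t_{\ell+1},\dots,t_d)\in(0,1)^{d-1}$. -/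

import Mathlib

open MeasureTheory Set Filter Topology
open scoped ContDiff

noncomputable section

/-- The classical partial derivative `∂ᵢ φ` on `ℝᵈ`. -/
def partialDeriv {d : ℕ} (i : Fin d) (φ : (Fin d → ℝ) → ℝ) : (Fin d → ℝ) → ℝ :=
  fun x => fderiv ℝ φ x (Pi.single i 1)

/-- The classical mixed derivative `∂₁^{r₁} ⋯ ∂_d^{r_d} φ` of multi-index `r`
(only ever applied to smooth functions). -/
def iterPartial {d : ℕ} (r : Fin d → ℕ) (φ : (Fin d → ℝ) → ℝ) : (Fin d → ℝ) → ℝ :=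
  (List.finRange d).foldr (fun i ψ => (partialDeriv i)^[r i] ψ) φ

/-- `v` is a weak derivative `D^r u` of `u` on the open set `Ω ⊆ ℝᵈ`: both functions are locally
integrable on `Ω` and `∫_Ω u D^r φ = (-1)^{|r|} ∫_Ω v φ` for all test functions
`φ ∈ C_c^∞(Ω)`. -/
structure IsWeakDeriv {d : ℕ} (Ω : Set (Fin d → ℝ)) (r : Fin d → ℕ)
    (u v : (Fin d → ℝ) → ℝ) : Prop where
  locallyIntegrable_left : LocallyIntegrableOn u Ω volume
  locallyIntegrable_right : LocallyIntegrableOn v Ω volume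
  integral_eq : ∀ φ : (Fin d → ℝ) → ℝ, ContDiff ℝ ∞ φ → HasCompactSupport φ → tsupport φ ⊆ Ω →
    ∫ x in Ω, u x * iterPartial r φ x = (-1) ^ (∑ i, r i) * ∫ x in Ω, v x * φ x

/-- On an open set, weak derivatives are unique up to null sets. -/
theorem IsWeakDeriv.ae_eq {d : ℕ} {Ω : Set (Fin d → ℝ)} (hΩ : IsOpen Ω) {r : Fin d → ℕ}
    {u v w : (Fin d → ℝ) → ℝ} (hv : IsWeakDeriv Ω r u v) (hw : IsWeakDeriv Ω r u w) :
    ∀ᵐ x ∂(volume : Measure (Fin d → ℝ)), x ∈ Ω → v x = w x := by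
  have key : ∀ᵐ x ∂(volume : Measure (Fin d → ℝ)), x ∈ Ω → (v - w) x = 0 := by
    refine hΩ.ae_eq_zero_of_integral_contDiff_smul_eq_zero
      (hv.locallyIntegrable_right.sub hw.locallyIntegrable_right) ?_
    intro φ hφ hc hs
    have h := (hv.integral_eq φ hφ hc hs).symm.trans (hw.integral_eq φ hφ hc hs)
    have h' := mul_left_cancel₀ (pow_ne_zero _ (by norm_num)) h
    have hint : ∀ z : (Fin d → ℝ) → ℝ, LocallyIntegrableOn z Ω volume →
        Integrable (fun x => φ x * z x) volume := by
      intro z hz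
      have hK := hz.integrableOn_compact_subset hs hc
      have h1 : IntegrableOn (fun x => φ x * z x) (tsupport φ) volume :=
        hK.continuousOn_mul hφ.continuous.continuousOn hc
      refine (integrableOn_iff_integrable_of_support_subset ?_).1 h1
      intro x hx
      exact subset_tsupport _ (left_ne_zero_of_mul hx)
    have hset : ∀ z : (Fin d → ℝ) → ℝ, ∫ x in Ω, z x * φ x = ∫ x, φ x * z x := by
      intro z
      rw [setIntegral_eq_integral_of_forall_compl_eq_zero]
      · simp only [mul_comm]
      · intro x hx
        rw [image_eq_zero_of_notMem_tsupport (fun hx' => hx (hs hx')), mul_zero]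
    simp only [Pi.sub_apply, smul_eq_mul, mul_sub]
    rw [integral_sub (hint v hv.locallyIntegrable_right) (hint w hw.locallyIntegrable_right),
      ← hset v, ← hset w, h', sub_self]
  filter_upwards [key] with x hx hxΩ
  exact sub_eq_zero.1 (hx hxΩ)

open Classical in
/-- The weak derivative `D^r u` on `Ω` (a representative; `0` if there is none). -/
def weakDeriv {d : ℕ} (Ω : Set (Fin d → ℝ)) (r : Fin d → ℕ) (u : (Fin d → ℝ) → ℝ) :
    (Fin d → ℝ) → ℝ :=
  if h : ∃ v, IsWeakDeriv Ω r u v then h.choose else 0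

/-- The standard Gaussian density `ρ(x) = e^{-|x|²/2} / (2π)^{d/2}` on `ℝᵈ`. -/
def gaussDensity {d : ℕ} (x : Fin d → ℝ) : ℝ :=
  Real.exp (-(∑ i, x i ^ 2) / 2) / (2 * Real.pi) ^ ((d : ℝ) / 2)

/-- The measure `ρ(x) dx`. -/
def gaussMeasure (d : ℕ) : Measure (Fin d → ℝ) :=
  volume.withDensity (fun x => ENNReal.ofReal (gaussDensity x))

/-- Membership in the Gaussian Sobolev space `H_ρ^α(ℝᵈ)` of dominating mixed smoothness: for all
`r ∈ {0,…,α}ᵈ` the weak derivative `D^r f` exists and belongs to `L²_ρ(ℝᵈ)`. -/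
def MemGaussSobolev {d : ℕ} (α : ℕ) (f : (Fin d → ℝ) → ℝ) : Prop :=
  ∀ r : Fin d → ℕ, (∀ k, r k ≤ α) → ∃ v, IsWeakDeriv univ r f v ∧ MemLp v 2 (gaussMeasure d)

/-- The norm `‖f‖_{H_ρ^α} = (∑_{|r|_∞ ≤ α} ‖D^r f‖²_{L²_ρ})^{1/2}`. -/
def gaussSobolevNorm {d : ℕ} (α : ℕ) (f : (Fin d → ℝ) → ℝ) : ℝ :=
  Real.sqrt (∑ r ∈ Fintype.piFinset (fun _ : Fin d => Finset.range (α + 1)),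
    (eLpNorm (weakDeriv univ r f) 2 (gaussMeasure d)).toReal ^ 2)

/-- `φ(t) = -cot(π t)`. -/
def cotMap (t : ℝ) : ℝ := -Real.cot (Real.pi * t)

/-- The componentwise map `Ψ_cot : (0,1)ᵈ → ℝᵈ`. -/
def cotMapVec {d : ℕ} (t : Fin d → ℝ) : Fin d → ℝ := fun k => cotMap (t k)

/-- `g(t) = f(Ψ_cot(t)) ρ(Ψ_cot(t)) ∏ₖ φ'(tₖ)`. -/
def cotTransform {d : ℕ} (f : (Fin d → ℝ) → ℝ) (t : Fin d → ℝ) : ℝ :=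
  f (cotMapVec t) * gaussDensity (cotMapVec t) * ∏ k, deriv cotMap (t k)

/-- The open unit cube `(0,1)ᵈ`; its boundary is a Lebesgue null set, so that
`L²((0,1)ᵈ) = L²([0,1]ᵈ)`. -/
def unitCube (d : ℕ) : Set (Fin d → ℝ) := {t | ∀ k, t k ∈ Ioo (0 : ℝ) 1}

/-- The point of `ℝᵈ` with `ℓ`-th coordinate `s` and remaining coordinates `y`. -/
def insertCoord {d : ℕ} (ℓ : Fin d) (y : {k : Fin d // k ≠ ℓ} → ℝ) (s : ℝ) : Fin d → ℝ :=
  fun k => if h : k = ℓ then s else y ⟨k, h⟩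

/-- On the line through `y` in direction `ℓ`, the function `t_ℓ ↦ G(t)` is continuous on `(0,1)`,
tends to `0` as `t_ℓ → 0+` and as `t_ℓ → 1-`, and its extension by zero is continuous
on `[0,1]`. -/
structure VanishesAtEnds {d : ℕ} (G : (Fin d → ℝ) → ℝ) (ℓ : Fin d)
    (y : {k : Fin d // k ≠ ℓ} → ℝ) : Prop where
  continuousOn : ContinuousOn (fun s => G (insertCoord ℓ y s)) (Ioo 0 1)
  tendsto_zero : Tendsto (fun s => G (insertCoord ℓ y s)) (𝓝[>] 0) (𝓝 0)
  tendsto_one : Tendsto (fun s => G (insertCoord ℓ y s)) (𝓝[<] 1) (𝓝 0)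
  continuousOn_extension :
    ContinuousOn ((Ioo (0 : ℝ) 1).indicator (fun s => G (insertCoord ℓ y s))) (Icc 0 1)

end

/-! Substitute x = Ψ_cot(t). Since φ' = π(1 + x²), each ∂/∂t_k becomes π(1 + x_k²) ∂/∂x_k, and dt
becomes ∏ dx_k / (π(1 + x_k²)). In the variable x, D^r g is therefore a finite sum of terms ∏
p_{r_k,s_k}(x_k) · ρ(x) · D^s f(x) with polynomials p and s ≤ r (`cotSum`). One factor √ρ absorbs
the polynomials, the other is paired with D^s f ∈ L²_ρ. This gives the norm bound
(`eLpNorm_cotCoeffVec_mul_le`) and integrability on ℝᵈ (`integrable_cotCoeffVec_mul`).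

For integrable functions on ℝᵈ, integration by parts needs only bounded test functions. Back on the
cube it thus holds against every φ ∈ C_c^∞(ℝᵈ), including those that do not vanish on the boundary
(`integral_cotSum_mul_partialDeriv`): a weak form of zero trace. Testing with integrals of φ along
segments parallel to e_ℓ yields two facts: D^r g is a.e. the primitive, starting at t_ℓ = 0, of
D^{r+e_ℓ} g, and the integral of D^{r+e_ℓ} g over almost every full segment is zero.

Let S be the set of k with r_k < α and V = D^{r+1_S} g. By iteration D^r g is a.e. the primitive of
V in all variables of S at once, and this primitive, taken pointwise, is the representative. On
every fibre in the directions S on which V is integrable it is continuous. At t_ℓ = 0 it vanishes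
because the range of integration is null, at t_ℓ = 1 because full integrals vanish. Almost every
fibre is of this kind, which is (a); if S contains all directions there is a single fibre, which is
(b). -/

noncomputable section

/-! ### Integrating out some of several independent variables -/

section PartialIntegral

variable {ι : Type*} [Fintype ι] [DecidableEq ι] {μ : ι → Measure ℝ}
  [∀ i, IsProbabilityMeasure (μ i)]

/-- Exchanging the coordinates in `S` between two independent copies preserves the measure. -/
theorem measurePreserving_piecewise_swap (S : Finset ι) :
    MeasurePreserving
      (fun p : (ι → ℝ) × (ι → ℝ) => (S.piecewise p.2 p.1, S.piecewise p.1 p.2))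
      ((Measure.pi μ).prod (Measure.pi μ)) ((Measure.pi μ).prod (Measure.pi μ)) := by
  -- Seen as a family of pairs, the exchange acts on each coordinate separately, by a swap or by the
  -- identity.
  have e := measurePreserving_arrowProdEquivProdArrow ℝ ℝ ι μ μ
  have h : MeasurePreserving
      (fun (a : ι → ℝ × ℝ) i => (if i ∈ S then Prod.swap else id : ℝ × ℝ → ℝ × ℝ) (a i))
      (Measure.pi fun i => (μ i).prod (μ i)) (Measure.pi fun i => (μ i).prod (μ i)) := by
    refine measurePreserving_pi _ _ fun i => ?_
    split_ifs
    · exact Measure.measurePreserving_swap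
    · exact MeasurePreserving.id _
  convert! (e.comp h).comp (e.symm _) using 1
  funext p
  refine Prod.ext ?_ ?_ <;> funext i <;> by_cases hi : i ∈ S <;>
    simp [hi, MeasurableEquiv.arrowProdEquivProdArrow, Equiv.arrowProdEquivProdArrow]

/-- Resampling the coordinates in `S` from an independent copy does not change the law. This takes
the place of Fubini for a splitting of `ι`: integrals run over all of `ι → ℝ`, and superfluous
coordinates cost nothing because the measures are probabilities. -/
theorem measurePreserving_piecewise (S : Finset ι) :
    MeasurePreserving (fun p : (ι → ℝ) × (ι → ℝ) => S.piecewise p.2 p.1)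
      ((Measure.pi μ).prod (Measure.pi μ)) (Measure.pi μ) :=
  measurePreserving_fst.comp (measurePreserving_piecewise_swap S)

theorem ae_ae_piecewise (S : Finset ι) {p : (ι → ℝ) → Prop} (h : ∀ᵐ x ∂Measure.pi μ, p x) :
    ∀ᵐ x ∂Measure.pi μ, ∀ᵐ s ∂Measure.pi μ, p (S.piecewise s x) :=
  Measure.ae_ae_of_ae_prod ((measurePreserving_piecewise S).quasiMeasurePreserving.ae h)

theorem ae_integrable_piecewise (S : Finset ι) {V : (ι → ℝ) → ℝ}
    (hV : Integrable V (Measure.pi μ)) :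
    ∀ᵐ x ∂Measure.pi μ, Integrable (fun s => V (S.piecewise s x)) (Measure.pi μ) :=
  ((measurePreserving_piecewise S).integrable_comp_of_integrable hV).prod_right_ae

omit [Fintype ι] [DecidableEq ι] in
theorem measurableSet_le_on (T : Finset ι) (x : ι → ℝ) :
    MeasurableSet {s : ι → ℝ | ∀ k ∈ T, s k ≤ x k} := by
  simp only [ofPred_forall]
  exact Finset.measurableSet_biInter _ fun k _ =>
    measurableSet_le (measurable_pi_apply k) measurable_const

omit [Fintype ι] [DecidableEq ι] in
theorem measurableSet_prod_le_on (T : Finset ι) :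
    MeasurableSet {p : (ι → ℝ) × (ι → ℝ) | ∀ k ∈ T, p.1 k ≤ p.2 k} := by
  simp only [ofPred_forall]
  exact Finset.measurableSet_biInter _ fun k _ =>
    measurableSet_le (by fun_prop) (by fun_prop)

variable (μ) in
/-- The variables in `S` are integrated out, those in `T` only up to the value in `x`. -/
def partialIntegral (S T : Finset ι) (V : (ι → ℝ) → ℝ) (x : ι → ℝ) : ℝ :=
  ∫ s, {s : ι → ℝ | ∀ k ∈ T, s k ≤ x k}.indicator (fun s => V (S.piecewise s x)) s ∂Measure.pi μ

theorem partialIntegral_empty (V : (ι → ℝ) → ℝ) : partialIntegral μ ∅ ∅ V = V := by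
  funext x
  simp [partialIntegral]

theorem partialIntegral_congr_ae (S T : Finset ι) {V V' : (ι → ℝ) → ℝ}
    (h : V =ᵐ[Measure.pi μ] V') :
    partialIntegral μ S T V =ᵐ[Measure.pi μ] partialIntegral μ S T V' := by
  filter_upwards [ae_ae_piecewise S h] with x hx
  refine integral_congr_ae ?_
  filter_upwards [hx] with s hs
  simp only [indicator, hs]

/-- Fubini: the inner and outer samples merge into the single sample `S'.piecewise s' s`, which
again has law `Measure.pi μ`. Disjointness and `T ⊆ S`, `T' ⊆ S'` let both constraints be read off
from the merged sample. -/
theorem partialIntegral_comp {S S' T T' : Finset ι} (hS : Disjoint S S') (hT : T ⊆ S)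
    (hT' : T' ⊆ S') {V : (ι → ℝ) → ℝ} (hV : Integrable V (Measure.pi μ)) :
    partialIntegral μ S T (partialIntegral μ S' T' V) =ᵐ[Measure.pi μ]
      partialIntegral μ (S ∪ S') (T ∪ T') V := by
  filter_upwards [ae_integrable_piecewise (S ∪ S') hV] with x hx
  set H : (ι → ℝ) → ℝ := {s : ι → ℝ | ∀ k ∈ T ∪ T', s k ≤ x k}.indicator
    (fun s => V ((S ∪ S').piecewise s x)) with hH
  have hHi : Integrable H (Measure.pi μ) := hx.indicator (measurableSet_le_on _ _)
  have hd : ∀ k ∈ S, k ∉ S' := fun k hk hk' => Finset.disjoint_left.1 hS hk hk'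
  have key : ∀ s s' : ι → ℝ, {s : ι → ℝ | ∀ k ∈ T, s k ≤ x k}.indicator (fun s =>
      {s' : ι → ℝ | ∀ k ∈ T', s' k ≤ (S.piecewise s x) k}.indicator
        (fun s' => V (S'.piecewise s' (S.piecewise s x))) s') s = H (S'.piecewise s' s) := by
    intro s s'
    have h1 : S'.piecewise s' (S.piecewise s x) =
        (S ∪ S').piecewise (S'.piecewise s' s) x := by
      funext k
      by_cases h : k ∈ S' <;> by_cases h2 : k ∈ S <;> simp [h, h2]
    have h2 : (∀ k ∈ T, s k ≤ x k) ↔ ∀ k ∈ T, S'.piecewise s' s k ≤ x k :=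
      forall₂_congr fun k hk => by simp [hd k (hT hk)]
    have h3 : (∀ k ∈ T', s' k ≤ S.piecewise s x k) ↔ ∀ k ∈ T', S'.piecewise s' s k ≤ x k :=
      forall₂_congr fun k hk => by
        have : k ∉ S := fun h => hd k h (hT' hk)
        simp [hT' hk, this]
    simp only [hH, indicator, mem_ofPred_eq, h1, h2, h3, Finset.forall_mem_union]
    split_ifs <;> first | rfl | simp_all
  have hint : Integrable (fun p : (ι → ℝ) × (ι → ℝ) => H (S'.piecewise p.2 p.1))
      ((Measure.pi μ).prod (Measure.pi μ)) :=
    (measurePreserving_piecewise S').integrable_comp_of_integrable hHi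
  calc partialIntegral μ S T (partialIntegral μ S' T' V) x
      = ∫ s, ∫ s', H (S'.piecewise s' s) ∂Measure.pi μ ∂Measure.pi μ := by
        refine integral_congr_ae (ae_of_all _ fun s => ?_)
        simp only [← key]
        by_cases h : s ∈ {s : ι → ℝ | ∀ k ∈ T, s k ≤ x k}
        · simp only [indicator_of_mem h]; rfl
        · simp only [indicator_of_notMem h, integral_zero]
    _ = ∫ p, H (S'.piecewise p.2 p.1) ∂(Measure.pi μ).prod (Measure.pi μ) :=
        (integral_prod _ hint).symm
    _ = ∫ s, H s ∂Measure.pi μ := by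
        have hmp := measurePreserving_piecewise (μ := μ) S'
        conv_rhs => rw [← hmp.map_eq, integral_map hmp.measurable.aemeasurable
          (by rw [hmp.map_eq]; exact hHi.aestronglyMeasurable)]
    _ = _ := rfl

/-- The adjoint of the partial integral. Exchanging the `S`-coordinates of the two variables
preserves the product measure and turns the constraint "sample below the point" into "sample above
the point". -/
theorem integral_partialIntegral_mul {S T : Finset ι} (hT : T ⊆ S) {V φ : (ι → ℝ) → ℝ}
    (hV : Integrable V (Measure.pi μ)) (hφ : Measurable φ) {B : ℝ} (hB : ∀ x, |φ x| ≤ B) :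
    ∫ x, partialIntegral μ S T V x * φ x ∂Measure.pi μ =
      ∫ a, V a * ∫ b, {b : ι → ℝ | ∀ k ∈ T, a k ≤ b k}.indicator
        (fun b => φ (S.piecewise b a)) b ∂Measure.pi μ ∂Measure.pi μ := by
  set H : (ι → ℝ) × (ι → ℝ) → ℝ := fun p =>
    V p.1 * {p : (ι → ℝ) × (ι → ℝ) | ∀ k ∈ T, p.1 k ≤ p.2 k}.indicator
      (fun p => φ (S.piecewise p.2 p.1)) p with hH
  have hHi : Integrable H ((Measure.pi μ).prod (Measure.pi μ)) := by
    refine (hV.comp_fst (Measure.pi μ)).mul_bdd (c := B) ?_ (ae_of_all _ fun p => ?_)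
    · exact ((hφ.comp (measurePreserving_piecewise (μ := μ) S).measurable).indicator
        (measurableSet_prod_le_on T)).aestronglyMeasurable
    · refine (norm_indicator_le_norm_self _ _).trans (hB _)
  have hmp := measurePreserving_piecewise_swap (μ := μ) S
  have hHs := hmp.integrable_comp_of_integrable hHi
  have key : ∀ x s : ι → ℝ, H (S.piecewise s x, S.piecewise x s) =
      {s : ι → ℝ | ∀ k ∈ T, s k ≤ x k}.indicator (fun s => V (S.piecewise s x)) s * φ x := by
    intro x s
    have h1 : S.piecewise (S.piecewise x s) (S.piecewise s x) = x := by
      funext k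
      by_cases h : k ∈ S <;> simp [h]
    have h2 : (∀ k ∈ T, S.piecewise s x k ≤ S.piecewise x s k) ↔ ∀ k ∈ T, s k ≤ x k :=
      forall₂_congr fun k hk => by simp [hT hk]
    simp only [hH, indicator, mem_ofPred_eq, h1, h2]
    split_ifs <;> simp
  calc ∫ x, partialIntegral μ S T V x * φ x ∂Measure.pi μ
      = ∫ x, ∫ s, H (S.piecewise s x, S.piecewise x s) ∂Measure.pi μ ∂Measure.pi μ := by
        refine integral_congr_ae (ae_of_all _ fun x => ?_)
        simp only [key, integral_mul_const]
        rfl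
    _ = ∫ p, H (S.piecewise p.2 p.1, S.piecewise p.1 p.2)
          ∂(Measure.pi μ).prod (Measure.pi μ) := (integral_prod _ hHs).symm
    _ = ∫ p, H p ∂(Measure.pi μ).prod (Measure.pi μ) := by
        conv_rhs => rw [← hmp.map_eq, integral_map hmp.measurable.aemeasurable
          (by rw [hmp.map_eq]; exact hHi.aestronglyMeasurable)]
    _ = _ := by
        rw [integral_prod _ hHi]
        refine integral_congr_ae (ae_of_all _ fun a => ?_)
        simp only [hH, integral_const_mul]
        rfl

theorem integrable_partialIntegral {S T : Finset ι} {V : (ι → ℝ) → ℝ}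
    (hV : Integrable V (Measure.pi μ)) :
    Integrable (partialIntegral μ S T V) (Measure.pi μ) := by
  have h := ((measurePreserving_piecewise (μ := μ) S).integrable_comp_of_integrable hV).indicator
    ((measurableSet_prod_le_on T).preimage measurable_swap)
  exact h.integral_prod_left

/-- Dominated convergence on one fibre: moving the point in the directions `S` changes only the
limits of integration, not the integrand `V`. -/
theorem continuous_partialIntegral [∀ i, NullSingletonClass (μ i)] {S T : Finset ι}
    {V : (ι → ℝ) → ℝ}
    {x : ι → ℝ} (hx : Integrable (fun s => V (S.piecewise s x)) (Measure.pi μ)) :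
    Continuous fun z => partialIntegral μ S T V (S.piecewise z x) := by
  have hpw : ∀ s z : ι → ℝ, S.piecewise s (S.piecewise z x) = S.piecewise s x := by
    intro s z
    funext k
    by_cases h : k ∈ S <;> simp [h]
  simp only [partialIntegral, hpw]
  refine continuous_iff_continuousAt.2 fun z₀ => ?_
  refine continuousAt_of_dominated (bound := fun s => ‖V (S.piecewise s x)‖) ?_ ?_ hx.norm ?_
  · exact Eventually.of_forall fun z =>
      hx.aestronglyMeasurable.indicator (measurableSet_le_on T _)
  · exact Eventually.of_forall fun z => ae_of_all _ fun s => norm_indicator_le_norm_self _ _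
  -- Off this null set all comparisons are strict at `z₀`, so the indicator is locally constant in
  -- `z`.
  · have hne : ∀ᵐ s ∂Measure.pi μ, ∀ k, s k ≠ S.piecewise z₀ x k :=
      ae_all_iff.2 fun k => Measure.ae_eval_ne (μ := μ) k _
    filter_upwards [hne] with s hs
    have hc : ∀ k, Continuous fun z : ι → ℝ => S.piecewise z x k := by
      intro k
      by_cases h : k ∈ S <;> simp only [Finset.piecewise, h, if_true, if_false] <;> fun_prop
    have hev : ∀ᶠ z in 𝓝 z₀, ∀ k, (s k ≤ S.piecewise z x k ↔ s k ≤ S.piecewise z₀ x k) := by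
      refine eventually_all.2 fun k => ?_
      rcases lt_or_gt_of_ne (hs k) with h | h
      · filter_upwards [(hc k).continuousAt.eventually_mem (Ioi_mem_nhds h)] with z hz
        exact ⟨fun _ => h.le, fun _ => le_of_lt hz⟩
      · filter_upwards [(hc k).continuousAt.eventually_mem (Iio_mem_nhds h)] with z hz
        exact ⟨fun h' => absurd (lt_of_lt_of_le (mem_Iio.1 hz) h') (lt_irrefl _),
          fun h' => absurd (lt_of_lt_of_le h h') (lt_irrefl _)⟩
    refine continuousAt_const.congr (f := fun _ => {s : ι → ℝ | ∀ k ∈ T,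
      s k ≤ S.piecewise z₀ x k}.indicator (fun s => V (S.piecewise s x)) s) ?_
    filter_upwards [hev] with z hz
    simp only [indicator, mem_ofPred_eq, hz]

end PartialIntegral

/-! ### Classical partial derivatives and their commutation -/

section PartialDeriv

variable {d : ℕ}

theorem hasDerivAt_comp_update {φ : (Fin d → ℝ) → ℝ} (ℓ : Fin d) (x : Fin d → ℝ) (t : ℝ)
    (h : DifferentiableAt ℝ φ (Function.update x ℓ t)) :
    HasDerivAt (fun s => φ (Function.update x ℓ s))
      (partialDeriv ℓ φ (Function.update x ℓ t)) t :=
  h.hasFDerivAt.comp_hasDerivAt t (hasDerivAt_update x ℓ t)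

theorem partialDeriv_eq_of_hasDerivAt {φ : (Fin d → ℝ) → ℝ} {ℓ : Fin d} {x : Fin d → ℝ} {D : ℝ}
    (h : DifferentiableAt ℝ φ x)
    (hD : HasDerivAt (fun s => φ (Function.update x ℓ s)) D (x ℓ)) :
    partialDeriv ℓ φ x = D := by
  have := hasDerivAt_comp_update ℓ x (x ℓ) (by rwa [Function.update_eq_self])
  rw [Function.update_eq_self] at this
  exact this.unique hD

theorem ContDiff.partialDeriv {φ : (Fin d → ℝ) → ℝ} (h : ContDiff ℝ ∞ φ) (ℓ : Fin d) :
    ContDiff ℝ ∞ (partialDeriv ℓ φ) :=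
  (h.fderiv_right (m := ∞) (by simp)).clm_apply contDiff_const

theorem support_partialDeriv_subset (φ : (Fin d → ℝ) → ℝ) (ℓ : Fin d) :
    Function.support (partialDeriv ℓ φ) ⊆ tsupport φ := by
  refine subset_trans (fun x hx => ?_) (support_fderiv_subset ℝ (f := φ))
  intro h
  exact hx (by simp [partialDeriv, h])

theorem HasCompactSupport.partialDeriv {φ : (Fin d → ℝ) → ℝ} (h : HasCompactSupport φ)
    (ℓ : Fin d) : HasCompactSupport (partialDeriv ℓ φ) :=
  h.mono' (support_partialDeriv_subset φ ℓ)

theorem partialDeriv_mul {φ ψ : (Fin d → ℝ) → ℝ} (ℓ : Fin d) (hφ : ContDiff ℝ ∞ φ)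
    (hψ : ContDiff ℝ ∞ ψ) (x : Fin d → ℝ) :
    partialDeriv ℓ (fun x => φ x * ψ x) x =
      partialDeriv ℓ φ x * ψ x + φ x * partialDeriv ℓ ψ x := by
  have h1 := (hφ.differentiable (by simp)).differentiableAt (x := x)
  have h2 := (hψ.differentiable (by simp)).differentiableAt (x := x)
  simp only [partialDeriv]
  rw [fderiv_fun_mul h1 h2]
  simp
  ring

theorem partialDeriv_comm {φ : (Fin d → ℝ) → ℝ} (hφ : ContDiff ℝ ∞ φ) (i j : Fin d) :
    partialDeriv i (partialDeriv j φ) = partialDeriv j (partialDeriv i φ) := by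
  have h1 : Differentiable ℝ (fderiv ℝ φ) :=
    (hφ.fderiv_right (m := ∞) (by simp)).differentiable (by simp)
  have h2 : ∀ (k l : Fin d) (x : Fin d → ℝ), partialDeriv k (partialDeriv l φ) x =
      fderiv ℝ (fderiv ℝ φ) x (Pi.single k 1) (Pi.single l 1) := by
    intro k l x
    unfold partialDeriv
    rw [fderiv_clm_apply h1.differentiableAt (differentiableAt_const _)]
    simp
  funext x
  rw [h2, h2]
  exact (hφ.contDiffAt.isSymmSndFDerivAt (by simpa using ENat.LEInfty.out)) _ _

theorem ContDiff.iterate_partialDeriv {φ : (Fin d → ℝ) → ℝ} (h : ContDiff ℝ ∞ φ) (ℓ : Fin d)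
    (n : ℕ) : ContDiff ℝ ∞ ((_root_.partialDeriv ℓ)^[n] φ) := by
  induction n with
  | zero => exact h
  | succ n ih => rw [Function.iterate_succ_apply']; exact ih.partialDeriv ℓ

theorem iterate_partialDeriv_comm {φ : (Fin d → ℝ) → ℝ} (h : ContDiff ℝ ∞ φ) (i j : Fin d)
    (n : ℕ) : (partialDeriv i)^[n] (partialDeriv j φ) = partialDeriv j ((partialDeriv i)^[n] φ) := by
  induction n with
  | zero => rfl
  | succ n ih =>
    rw [Function.iterate_succ_apply', ih, Function.iterate_succ_apply',
      partialDeriv_comm (h.iterate_partialDeriv i n)]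

theorem ContDiff.foldr_partialDeriv {φ : (Fin d → ℝ) → ℝ} (h : ContDiff ℝ ∞ φ) (r : Fin d → ℕ)
    (l : List (Fin d)) :
    ContDiff ℝ ∞ (l.foldr (fun i ψ => (_root_.partialDeriv i)^[r i] ψ) φ) := by
  induction l with
  | nil => exact h
  | cons i l ih => exact ih.iterate_partialDeriv i _

theorem foldr_partialDeriv_comm {φ : (Fin d → ℝ) → ℝ} (h : ContDiff ℝ ∞ φ) (r : Fin d → ℕ)
    (l : List (Fin d)) (j : Fin d) :
    l.foldr (fun i ψ => (partialDeriv i)^[r i] ψ) (partialDeriv j φ) =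
      partialDeriv j (l.foldr (fun i ψ => (partialDeriv i)^[r i] ψ) φ) := by
  induction l with
  | nil => rfl
  | cons i l ih =>
    rw [List.foldr_cons, ih, List.foldr_cons, iterate_partialDeriv_comm (h.foldr_partialDeriv r l)]

/-- The induction is over lists without repetition, so the extra derivative is picked up at most
once. -/
theorem foldr_partialDeriv_add_single {φ : (Fin d → ℝ) → ℝ} (h : ContDiff ℝ ∞ φ)
    (r : Fin d → ℕ) (j : Fin d) (l : List (Fin d)) (hl : l.Nodup) :
    l.foldr (fun i ψ => (partialDeriv i)^[(r + Pi.single j 1 : Fin d → ℕ) i] ψ) φ =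
      if j ∈ l then l.foldr (fun i ψ => (partialDeriv i)^[r i] ψ) (partialDeriv j φ)
      else l.foldr (fun i ψ => (partialDeriv i)^[r i] ψ) φ := by
  induction l with
  | nil => rfl
  | cons i l ih =>
    rw [List.nodup_cons] at hl
    rw [List.foldr_cons, ih hl.2]
    by_cases hij : j = i
    · subst hij
      simp only [hl.1, if_false, List.mem_cons, true_or, if_true, List.foldr_cons, Pi.add_apply,
        Pi.single_eq_same, Function.iterate_succ_apply']
      rw [foldr_partialDeriv_comm h, iterate_partialDeriv_comm (h.foldr_partialDeriv r l)]
    · have h0 : (r + Pi.single j 1 : Fin d → ℕ) i = r i := by simp [Ne.symm hij]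
      rw [h0]
      by_cases hj : j ∈ l <;> simp [hj, hij]

/-- Allows induction on |r|: one derivative is moved onto the test function. -/
theorem iterPartial_add_single {φ : (Fin d → ℝ) → ℝ} (h : ContDiff ℝ ∞ φ) (r : Fin d → ℕ)
    (j : Fin d) : iterPartial (r + Pi.single j 1) φ = iterPartial r (partialDeriv j φ) := by
  unfold iterPartial
  rw [foldr_partialDeriv_add_single h r j _ (List.nodup_finRange d)]
  simp

theorem iterPartial_zero (φ : (Fin d → ℝ) → ℝ) : iterPartial 0 φ = φ := by
  unfold iterPartial
  induction List.finRange d with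
  | nil => rfl
  | cons i l ih => rw [List.foldr_cons, ih]; rfl

end PartialDeriv

/-! ### Integrals of test functions along segments -/

section LineIntegral

variable {d : ℕ}

/-- The integral of `φ` over the segment from `x + a eₗ` to `x + b eₗ`. -/
def segmentIntegral (ℓ : Fin d) (a b : ℝ) (φ : (Fin d → ℝ) → ℝ) (x : Fin d → ℝ) : ℝ :=
  ∫ s in a..b, φ (Function.update x ℓ (x ℓ + s))

theorem contDiff_update_add (ℓ : Fin d) :
    ContDiff ℝ ∞ fun p : (Fin d → ℝ) × ℝ => Function.update p.1 ℓ (p.1 ℓ + p.2) := by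
  refine contDiff_pi.2 fun k => ?_
  by_cases h : k = ℓ
  · subst h; simp only [Function.update_self]; fun_prop
  · simp only [Function.update_of_ne h]; fun_prop

theorem exists_bound_of_hasCompactSupport {φ : (Fin d → ℝ) → ℝ} (hφ : HasCompactSupport φ) :
    ∃ R : ℝ, 0 < R ∧ ∀ x, φ x ≠ 0 → ∀ k, |x k| ≤ R := by
  obtain ⟨R, hR0, hR⟩ := hφ.isCompact.isBounded.exists_pos_norm_le
  exact ⟨R, hR0, fun x hx k => (norm_le_pi_norm x k).trans (hR x (subset_tsupport φ hx))⟩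

theorem contDiff_segmentIntegral (ℓ : Fin d) {a b : ℝ} (hab : a ≤ b) {φ : (Fin d → ℝ) → ℝ}
    (hφ : ContDiff ℝ ∞ φ) (hc : HasCompactSupport φ) :
    ContDiff ℝ ∞ (segmentIntegral ℓ a b φ) := by
  obtain ⟨R, hR0, hR⟩ := exists_bound_of_hasCompactSupport hc
  refine contDiff_iff_contDiffAt.2 fun x₀ => ?_
  have hf : LocallyIntegrable ((Ioc a b).indicator fun _ => (1 : ℝ)) volume :=
    (locallyIntegrable_const (1 : ℝ)).indicator measurableSet_Ioc
  -- The segment integral is the convolution at 0 of the indicator of `Ioc a b` with τ ↦ φ(x - τ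
  -- eₗ). A compact set containing the support in τ is uniform only for bounded `x`, hence the ball
  -- around `x₀`.
  have key := contDiffOn_convolution_right_with_param_comp (𝕜 := ℝ) (n := ⊤) (μ := volume)
    (ContinuousLinearMap.mul ℝ ℝ) (s := Metric.ball x₀ 1) (v := fun _ => (0 : ℝ))
    (f := (Ioc a b).indicator fun _ => (1 : ℝ))
    (g := fun x τ => φ (Function.update x ℓ (x ℓ + -τ)))
    (k := Metric.closedBall 0 (R + (‖x₀‖ + 1))) contDiffOn_const Metric.isOpen_ball
    (isCompact_closedBall _ _) ?_ hf ?_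
  · refine (key.contDiffAt (Metric.ball_mem_nhds _ one_pos)).congr_of_eventuallyEq
      (Eventually.of_forall fun x => ?_)
    simp only [segmentIntegral, intervalIntegral.integral_of_le hab, convolution,
      ContinuousLinearMap.mul_apply', zero_sub, neg_neg]
    rw [← integral_indicator measurableSet_Ioc]
    refine integral_congr_ae (ae_of_all _ fun s => ?_)
    by_cases hs : s ∈ Ioc a b <;> simp [hs]
  · intro x τ hx hτ
    by_contra hne
    have h1 := hR _ hne ℓ
    rw [Function.update_self] at h1
    refine hτ ?_
    rw [mem_closedBall_zero_iff, Real.norm_eq_abs]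
    have h2 : |x ℓ| ≤ ‖x₀‖ + 1 := by
      have h3 := norm_le_pi_norm x ℓ
      have h4 : ‖x‖ ≤ ‖x₀‖ + ‖x - x₀‖ := norm_le_norm_add_norm_sub' x x₀
      rw [Metric.mem_ball, dist_eq_norm] at hx
      rw [Real.norm_eq_abs] at h3
      linarith
    have h5 : |τ| ≤ |x ℓ| + |x ℓ + -τ| := by
      have := abs_sub (x ℓ) (x ℓ + -τ)
      rwa [show x ℓ - (x ℓ + -τ) = τ by ring] at this
    linarith
  · refine ContDiff.contDiffOn ?_
    have : (↿fun (x : Fin d → ℝ) (τ : ℝ) => φ (Function.update x ℓ (x ℓ + -τ))) =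
      φ ∘ (fun p : (Fin d → ℝ) × ℝ => Function.update p.1 ℓ (p.1 ℓ + p.2)) ∘
        (fun p => (p.1, -p.2)) := rfl
    rw [this]
    exact hφ.comp ((contDiff_update_add ℓ).comp (by fun_prop))

theorem hasCompactSupport_segmentIntegral (ℓ : Fin d) (a b : ℝ) {φ : (Fin d → ℝ) → ℝ}
    (hc : HasCompactSupport φ) : HasCompactSupport (segmentIntegral ℓ a b φ) := by
  obtain ⟨R, hR0, hR⟩ := exists_bound_of_hasCompactSupport hc
  refine HasCompactSupport.of_support_subset_isCompact
    (isCompact_closedBall (0 : Fin d → ℝ) (R + |a| + |b|)) fun x hx => ?_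
  by_contra hx'
  refine hx ?_
  rw [mem_closedBall_zero_iff, pi_norm_le_iff_of_nonneg (by positivity)] at hx'
  push Not at hx'
  obtain ⟨k, hk⟩ := hx'
  rw [Real.norm_eq_abs] at hk
  refine intervalIntegral.integral_zero_ae (ae_of_all _ fun s hs => ?_)
  by_contra hne
  have h1 := hR _ hne k
  by_cases h : k = ℓ
  · subst h
    rw [Function.update_self] at h1
    have hs' : |s| ≤ |a| + |b| := by
      rw [mem_uIoc] at hs
      rcases hs with hs | hs <;> rw [abs_le] <;> constructor <;>
        linarith [neg_abs_le a, neg_abs_le b, le_abs_self a, le_abs_self b, abs_nonneg a,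
          abs_nonneg b]
    have h5 : |x k| ≤ |x k + s| + |s| := by
      have := abs_sub (x k + s) s
      rwa [add_sub_cancel_right] at this
    linarith
  · rw [Function.update_of_ne h] at h1
    linarith [abs_nonneg a, abs_nonneg b]

/-- Fundamental theorem of calculus. For φ supported in the cube one or both of the boundary terms
vanish, depending on the segment; this is why segment integrals are used as test functions below. -/
theorem partialDeriv_segmentIntegral (ℓ : Fin d) {a b : ℝ} (hab : a ≤ b) {φ : (Fin d → ℝ) → ℝ}
    (hφ : ContDiff ℝ ∞ φ) (hc : HasCompactSupport φ) (x : Fin d → ℝ) :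
    partialDeriv ℓ (segmentIntegral ℓ a b φ) x =
      φ (Function.update x ℓ (x ℓ + b)) - φ (Function.update x ℓ (x ℓ + a)) := by
  refine partialDeriv_eq_of_hasDerivAt
    ((contDiff_segmentIntegral ℓ hab hφ hc).differentiable (by simp)).differentiableAt ?_
  set h : ℝ → ℝ := fun s => φ (Function.update x ℓ s) with hh
  have hcont : Continuous h :=
    hφ.continuous.comp (continuous_const.update ℓ continuous_id)
  have heq : (fun s => segmentIntegral ℓ a b φ (Function.update x ℓ s)) =
      fun s => (∫ t in (0 : ℝ)..(s + b), h t) - ∫ t in (0 : ℝ)..(s + a), h t := by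
    funext s
    rw [intervalIntegral.integral_interval_sub_left (hcont.intervalIntegrable _ _)
      (hcont.intervalIntegrable _ _), ← intervalIntegral.integral_comp_add_left]
    simp only [segmentIntegral, Function.update_self, Function.update_idem, hh]
  rw [heq]
  have hF : ∀ c : ℝ, HasDerivAt (fun s => ∫ t in (0 : ℝ)..(s + c), h t) (h (x ℓ + c)) (x ℓ) := by
    intro c
    have := (intervalIntegral.integral_hasDerivAt_right (hcont.intervalIntegrable 0 (x ℓ + c))
      hcont.aestronglyMeasurable.stronglyMeasurableAtFilter hcont.continuousAt)
    exact this.comp_add_const (x ℓ) c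
  exact (hF b).sub (hF a)

end LineIntegral

/-! ### First order weak derivatives on the whole space -/

section WeakPartial

variable {d : ℕ}

/-- `v` is the first order weak partial derivative `∂ₗ u` on `ℝᵈ`. -/
def IsWeakPartial (ℓ : Fin d) (u v : (Fin d → ℝ) → ℝ) : Prop :=
  ∀ φ : (Fin d → ℝ) → ℝ, ContDiff ℝ ∞ φ → HasCompactSupport φ →
    ∫ x, u x * partialDeriv ℓ φ x = -∫ x, v x * φ x

theorem MeasureTheory.LocallyIntegrable.integrable_mul_of_hasCompactSupport
    {u φ : (Fin d → ℝ) → ℝ} (hu : LocallyIntegrable u volume) (hφ : Continuous φ)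
    (hc : HasCompactSupport φ) : Integrable (fun x => u x * φ x) volume := by
  simpa only [smul_eq_mul] using hu.integrable_smul_right_of_hasCompactSupport hφ hc

theorem LocallyIntegrable.mul_continuous {u a : (Fin d → ℝ) → ℝ}
    (hu : LocallyIntegrable u volume) (ha : Continuous a) :
    LocallyIntegrable (fun x => a x * u x) volume := by
  rw [← locallyIntegrableOn_univ] at hu ⊢
  exact hu.continuousOn_mul ha.continuousOn isOpen_univ.isLocallyClosed

/-- Leibniz rule, obtained by using `a * φ` as a test function. -/
theorem IsWeakPartial.mul {ℓ : Fin d} {u v a : (Fin d → ℝ) → ℝ} (h : IsWeakPartial ℓ u v)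
    (hu : LocallyIntegrable u volume) (hv : LocallyIntegrable v volume) (ha : ContDiff ℝ ∞ a) :
    IsWeakPartial ℓ (fun x => a x * u x) (fun x => partialDeriv ℓ a x * u x + a x * v x) := by
  intro φ hφ hc
  have h1 := h (fun x => a x * φ x) (ha.mul hφ) hc.mul_left
  simp only [partialDeriv_mul ℓ ha hφ] at h1
  have i1 : Integrable (fun x => u x * (partialDeriv ℓ a x * φ x)) volume :=
    hu.integrable_mul_of_hasCompactSupport ((ha.partialDeriv ℓ).continuous.mul hφ.continuous)
      hc.mul_left
  have i2 : Integrable (fun x => u x * (a x * partialDeriv ℓ φ x)) volume :=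
    hu.integrable_mul_of_hasCompactSupport (ha.continuous.mul (hφ.partialDeriv ℓ).continuous)
      (hc.partialDeriv ℓ).mul_left
  have i3 : Integrable (fun x => v x * (a x * φ x)) volume :=
    hv.integrable_mul_of_hasCompactSupport (ha.continuous.mul hφ.continuous) hc.mul_left
  have e1 : ∫ x, u x * (partialDeriv ℓ a x * φ x + a x * partialDeriv ℓ φ x) =
      (∫ x, u x * (partialDeriv ℓ a x * φ x)) + ∫ x, u x * (a x * partialDeriv ℓ φ x) := by
    rw [← integral_add i1 i2]
    simp only [mul_add]
  have e2 : ∫ x, (partialDeriv ℓ a x * u x + a x * v x) * φ x =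
      (∫ x, u x * (partialDeriv ℓ a x * φ x)) + ∫ x, v x * (a x * φ x) := by
    rw [← integral_add i1 i3]
    refine integral_congr_ae (ae_of_all _ fun x => ?_)
    simp only; ring
  have e3 : ∫ x, a x * u x * partialDeriv ℓ φ x = ∫ x, u x * (a x * partialDeriv ℓ φ x) := by
    refine integral_congr_ae (ae_of_all _ fun x => ?_)
    simp only; ring
  rw [e2, e3]
  linarith

theorem IsWeakPartial.sum {κ : Type*} {ℓ : Fin d} {s : Finset κ} {u v : κ → (Fin d → ℝ) → ℝ}
    (h : ∀ i ∈ s, IsWeakPartial ℓ (u i) (v i)) (hu : ∀ i ∈ s, LocallyIntegrable (u i) volume)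
    (hv : ∀ i ∈ s, LocallyIntegrable (v i) volume) :
    IsWeakPartial ℓ (fun x => ∑ i ∈ s, u i x) (fun x => ∑ i ∈ s, v i x) := by
  intro φ hφ hc
  simp only [Finset.sum_mul]
  rw [integral_finsetSum, integral_finsetSum, ← Finset.sum_neg_distrib]
  · exact Finset.sum_congr rfl fun i hi => h i hi φ hφ hc
  · exact fun i hi => (hv i hi).integrable_mul_of_hasCompactSupport hφ.continuous hc
  · exact fun i hi => (hu i hi).integrable_mul_of_hasCompactSupport
      (hφ.partialDeriv ℓ).continuous (hc.partialDeriv ℓ)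

/-- For integrable functions the test functions need not have compact support. -/
theorem IsWeakPartial.integral_eq_of_bounded {ℓ : Fin d} {u v χ : (Fin d → ℝ) → ℝ}
    (h : IsWeakPartial ℓ u v) (hu : Integrable u volume) (hv : Integrable v volume)
    (hχ : ContDiff ℝ ∞ χ) {B : ℝ} (hB : ∀ x, |χ x| ≤ B) (hB' : ∀ x, |partialDeriv ℓ χ x| ≤ B) :
    ∫ x, u x * partialDeriv ℓ χ x = -∫ x, v x * χ x := by
  let b : ContDiffBump (0 : Fin d → ℝ) := ⟨1, 2, one_pos, one_lt_two⟩
  set c : ℕ → ℝ := fun n => 1 / ((n : ℝ) + 1) with hc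
  have hcpos : ∀ n, 0 < c n := fun n => Nat.one_div_pos_of_nat
  have hc1 : ∀ n, c n ≤ 1 := fun n => by
    rw [hc]; simp only
    rw [div_le_one (by positivity)]
    linarith [(Nat.cast_nonneg n : (0 : ℝ) ≤ n)]
  have hc0 : Tendsto c atTop (𝓝 0) := tendsto_one_div_add_atTop_nhds_zero_nat
  -- Cutoffs at scale n + 1: they tend to 1 pointwise, their derivatives are of size 1 / (n + 1),
  -- and `c n ≤ 1` makes the dominating function below independent of `n`.
  set η : ℕ → (Fin d → ℝ) → ℝ := fun n x => b (c n • x) with hη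
  have hbs : ContDiff ℝ ∞ (b : (Fin d → ℝ) → ℝ) := b.contDiff
  have hηs : ∀ n, ContDiff ℝ ∞ (η n) := fun n => hbs.comp (by fun_prop)
  have hηc : ∀ n, HasCompactSupport (η n) := fun n =>
    b.hasCompactSupport.comp_smul (hcpos n).ne'
  have hη' : ∀ n x, partialDeriv ℓ (η n) x = c n * partialDeriv ℓ b (c n • x) := by
    intro n x
    have h1 : HasFDerivAt (η n) ((fderiv ℝ b (c n • x)).comp
        (c n • ContinuousLinearMap.id ℝ (Fin d → ℝ))) x :=
      ((hbs.differentiable (by simp)).differentiableAt.hasFDerivAt).comp x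
        ((hasFDerivAt_id x).const_smul (c n))
    simp [partialDeriv, h1.fderiv]
  obtain ⟨K, hK⟩ := (hbs.partialDeriv ℓ).continuous.bounded_above_of_compact_support
    (b.hasCompactSupport.partialDeriv ℓ)
  have hK0 : 0 ≤ K := (norm_nonneg _).trans (hK 0)
  have hB0 : 0 ≤ B := (abs_nonneg _).trans (hB 0)
  have hη1 : ∀ n x, |η n x| ≤ 1 := fun n x => by
    rw [abs_of_nonneg b.nonneg]; exact b.le_one
  have hηK : ∀ n x, |partialDeriv ℓ (η n) x| ≤ c n * K := fun n x => by
    rw [hη', abs_mul, abs_of_pos (hcpos n)]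
    exact mul_le_mul_of_nonneg_left (hK _) (hcpos n).le
  have hηt : ∀ x, Tendsto (fun n => η n x) atTop (𝓝 1) := by
    intro x
    have h1 : Tendsto (fun n => c n • x) atTop (𝓝 ((0 : ℝ) • x)) := hc0.smul_const x
    rw [zero_smul] at h1
    have h2 := (hbs.continuous.tendsto 0).comp h1
    rwa [show b 0 = 1 from b.one_of_mem_closedBall (by simp [b.rIn_pos.le])] at h2
  have hηt' : ∀ x, Tendsto (fun n => partialDeriv ℓ (η n) x) atTop (𝓝 0) := by
    intro x
    refine squeeze_zero_norm (hηK · x) ?_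
    simpa using hc0.mul_const K
  have heq : ∀ n, ∫ x, u x * (partialDeriv ℓ χ x * η n x + χ x * partialDeriv ℓ (η n) x) =
      -∫ x, v x * (χ x * η n x) := by
    intro n
    have := h (fun x => χ x * η n x) (hχ.mul (hηs n)) (hηc n).mul_left
    simpa only [partialDeriv_mul ℓ hχ (hηs n)] using this
  have hL : Tendsto (fun n => ∫ x, u x * (partialDeriv ℓ χ x * η n x +
      χ x * partialDeriv ℓ (η n) x)) atTop (𝓝 (∫ x, u x * partialDeriv ℓ χ x)) := by
    refine tendsto_integral_of_dominated_convergence (fun x => ‖u x‖ * (B + B * K)) ?_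
      (hu.norm.mul_const _) ?_ ?_
    · intro n
      exact hu.aestronglyMeasurable.mul
        (((hχ.partialDeriv ℓ).mul (hηs n)).add (hχ.mul ((hηs n).partialDeriv
          ℓ))).continuous.aestronglyMeasurable
    · intro n
      refine ae_of_all _ fun x => ?_
      rw [norm_mul]
      refine mul_le_mul_of_nonneg_left ((norm_add_le _ _).trans ?_) (norm_nonneg _)
      rw [norm_mul, norm_mul]
      have h1 : ‖partialDeriv ℓ χ x‖ * ‖η n x‖ ≤ B * 1 :=
        mul_le_mul (hB' x) (hη1 n x) (norm_nonneg _) hB0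
      have h2 : ‖χ x‖ * ‖partialDeriv ℓ (η n) x‖ ≤ B * K :=
        mul_le_mul (hB x) ((hηK n x).trans (mul_le_of_le_one_left hK0 (hc1 n)))
          (norm_nonneg _) hB0
      linarith
    · refine ae_of_all _ fun x => ?_
      have := (((hηt x).const_mul (partialDeriv ℓ χ x)).add
        ((hηt' x).const_mul (χ x))).const_mul (u x)
      simpa using this
  have hR : Tendsto (fun n => -∫ x, v x * (χ x * η n x)) atTop (𝓝 (-∫ x, v x * χ x)) := by
    refine (tendsto_integral_of_dominated_convergence (fun x => ‖v x‖ * B) ?_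
      (hv.norm.mul_const _) ?_ ?_).neg
    · intro n
      exact hv.aestronglyMeasurable.mul (hχ.mul (hηs n)).continuous.aestronglyMeasurable
    · intro n
      refine ae_of_all _ fun x => ?_
      rw [norm_mul, norm_mul]
      refine mul_le_mul_of_nonneg_left ?_ (norm_nonneg _)
      exact (mul_le_of_le_one_right (norm_nonneg _) (hη1 n x)).trans (hB x)
    · refine ae_of_all _ fun x => ?_
      have := ((hηt x).const_mul (χ x)).const_mul (v x)
      simpa using this
  exact tendsto_nhds_unique (hL.congr heq) hR

end WeakPartial

/-! ### The cotangent substitution -/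

section CotSubstitution

/-- The derivative `1 / (π (1 + x²))` of the inverse of `cotMap`. -/
def cauchyWeight (x : ℝ) : ℝ := (Real.pi * (1 + x ^ 2))⁻¹

/-- The inverse of `cotMap` on `(0,1)`. -/
def cotMapInv (x : ℝ) : ℝ := 1 / 2 + Real.arctan x / Real.pi

theorem cauchyWeight_pos (x : ℝ) : 0 < cauchyWeight x := by
  unfold cauchyWeight
  have := Real.pi_pos
  positivity

theorem cauchyWeight_le_one (x : ℝ) : cauchyWeight x ≤ 1 := by
  refine inv_le_one_of_one_le₀ ?_
  nlinarith [Real.pi_gt_three, sq_nonneg x]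

theorem contDiff_cauchyWeight : ContDiff ℝ ∞ cauchyWeight := by
  refine ContDiff.inv (by fun_prop) fun x => ?_
  have := Real.pi_pos
  positivity

theorem contDiff_cotMapInv : ContDiff ℝ ∞ cotMapInv :=
  contDiff_const.add (Real.contDiff_arctan.div_const _)

theorem hasDerivAt_cotMapInv (x : ℝ) : HasDerivAt cotMapInv (cauchyWeight x) x := by
  have h := ((Real.hasDerivAt_arctan x).div_const Real.pi).const_add (1 / 2)
  convert! h using 1
  unfold cauchyWeight
  have := Real.pi_pos
  field_simp

theorem cotMapInv_mem (x : ℝ) : cotMapInv x ∈ Ioo (0 : ℝ) 1 := by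
  have h1 := Real.arctan_lt_pi_div_two x
  have h2 := Real.neg_pi_div_two_lt_arctan x
  have hp := Real.pi_pos
  unfold cotMapInv
  constructor
  · have : -(1 / 2) < Real.arctan x / Real.pi := by
      rw [lt_div_iff₀ hp]; linarith
    linarith
  · have : Real.arctan x / Real.pi < 1 / 2 := by
      rw [div_lt_iff₀ hp]; linarith
    linarith

theorem cotMap_eq_tan (t : ℝ) : cotMap t = Real.tan (Real.pi * t - Real.pi / 2) := by
  unfold cotMap
  rw [Real.cot_eq_cos_div_sin, Real.tan_eq_sin_div_cos, Real.sin_sub_pi_div_two,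
    Real.cos_sub_pi_div_two, neg_div]

theorem cotMap_cotMapInv (x : ℝ) : cotMap (cotMapInv x) = x := by
  rw [cotMap_eq_tan, cotMapInv]
  have := Real.pi_pos
  rw [show Real.pi * (1 / 2 + Real.arctan x / Real.pi) - Real.pi / 2 = Real.arctan x by
    field_simp; ring, Real.tan_arctan]

theorem cotMapInv_cotMap {t : ℝ} (ht : t ∈ Ioo (0 : ℝ) 1) : cotMapInv (cotMap t) = t := by
  have hp := Real.pi_pos
  rw [cotMap_eq_tan, cotMapInv, Real.arctan_tan]
  · field_simp; ring
  · nlinarith [ht.1]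
  · nlinarith [ht.2]

theorem deriv_cotMap {t : ℝ} (ht : t ∈ Ioo (0 : ℝ) 1) :
    deriv cotMap t = Real.pi * (1 + cotMap t ^ 2) := by
  have hp := Real.pi_pos
  have hc : Real.cos (Real.pi * t - Real.pi / 2) ≠ 0 :=
    (Real.cos_pos_of_mem_Ioo ⟨by nlinarith [ht.1], by nlinarith [ht.2]⟩).ne'
  have h1 : HasDerivAt (fun t => Real.pi * t - Real.pi / 2) Real.pi t := by
    simpa using ((hasDerivAt_id t).const_mul Real.pi).sub_const (Real.pi / 2)
  have h2 := (Real.hasDerivAt_tan hc).comp t h1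
  have h3 : cotMap = Real.tan ∘ fun t => Real.pi * t - Real.pi / 2 := funext cotMap_eq_tan
  rw [h3, h2.deriv, ← h3, cotMap_eq_tan, one_div, ← Real.inv_one_add_tan_sq hc, inv_inv, mul_comm]

theorem injective_cotMapInv : Function.Injective cotMapInv :=
  Function.LeftInverse.injective cotMap_cotMapInv

theorem range_cotMapInv : range cotMapInv = Ioo (0 : ℝ) 1 :=
  subset_antisymm (range_subset_iff.2 cotMapInv_mem) fun t ht => ⟨cotMap t, cotMapInv_cotMap ht⟩

theorem integrable_cauchyWeight : Integrable cauchyWeight volume := by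
  have := integrable_inv_one_add_sq.const_mul Real.pi⁻¹
  refine this.congr (ae_of_all _ fun x => ?_)
  simp only [cauchyWeight, mul_inv]

/-- `cotMapInv` is the distribution function of the Cauchy law, so it sends that law to the uniform
one. -/
theorem measurePreserving_cotMapInv :
    MeasurePreserving cotMapInv (volume.withDensity fun x => ENNReal.ofReal (cauchyWeight x))
      (volume.restrict (Ioo 0 1)) := by
  have hm : Measurable cotMapInv := contDiff_cotMapInv.continuous.measurable
  refine ⟨hm, Measure.ext fun A hA => ?_⟩
  rw [Measure.map_apply hm hA, withDensity_apply _ (hm hA), Measure.restrict_apply hA]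
  have h := lintegral_image_eq_lintegral_abs_deriv_mul (s := cotMapInv ⁻¹' A) (hm hA)
    (fun x _ => (hasDerivAt_cotMapInv x).hasDerivWithinAt) injective_cotMapInv.injOn
    (fun _ => 1)
  simp only [mul_one, lintegral_one, Measure.restrict_apply_univ, image_preimage_eq_inter_range,
    range_cotMapInv, abs_of_pos (cauchyWeight_pos _)] at h
  exact h.symm

variable {d : ℕ}

/-- The uniform distribution on the unit cube. -/
abbrev cubeMeasure (d : ℕ) : Measure (Fin d → ℝ) :=
  Measure.pi fun _ => (volume : Measure ℝ).restrict (Ioo 0 1)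

instance isProbabilityMeasure_restrict_Ioo :
    IsProbabilityMeasure ((volume : Measure ℝ).restrict (Ioo 0 1)) :=
  ⟨by simp⟩

theorem unitCube_eq_pi : unitCube d = univ.pi fun _ => Ioo (0 : ℝ) 1 := by
  ext t; simp [unitCube]

theorem isOpen_unitCube : IsOpen (unitCube d) := by
  rw [unitCube_eq_pi]
  exact isOpen_set_pi finite_univ fun _ _ => isOpen_Ioo

theorem volume_restrict_unitCube : volume.restrict (unitCube d) = cubeMeasure d := by
  rw [unitCube_eq_pi, volume_pi, Measure.restrict_pi_pi]

theorem ae_mem_unitCube : ∀ᵐ t ∂cubeMeasure d, t ∈ unitCube d := by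
  rw [← volume_restrict_unitCube]
  exact ae_restrict_mem isOpen_unitCube.measurableSet

/-- The inverse of `cotMapVec` on the unit cube. -/
def cotMapInvVec (x : Fin d → ℝ) : Fin d → ℝ := fun k => cotMapInv (x k)

theorem cotMapVec_cotMapInvVec (x : Fin d → ℝ) : cotMapVec (cotMapInvVec x) = x :=
  funext fun k => cotMap_cotMapInv (x k)

theorem contDiff_cotMapInvVec : ContDiff ℝ ∞ (cotMapInvVec (d := d)) :=
  contDiff_pi.2 fun k => contDiff_cotMapInv.comp (contDiff_apply ℝ ℝ k)

theorem measurableEmbedding_cotMapInvVec : MeasurableEmbedding (cotMapInvVec (d := d)) :=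
  contDiff_cotMapInvVec.continuous.measurableEmbedding
    (Function.LeftInverse.injective cotMapVec_cotMapInvVec)

/-- The measure with density `∏ₖ 1 / (π (1 + xₖ²))`. -/
def cauchyVecMeasure (d : ℕ) : Measure (Fin d → ℝ) :=
  volume.withDensity fun x => ENNReal.ofReal (∏ k, cauchyWeight (x k))

theorem integrable_prod_cauchyWeight :
    Integrable (fun x : Fin d → ℝ => ∏ k, cauchyWeight (x k)) volume :=
  Integrable.fintype_prod fun _ => integrable_cauchyWeight

theorem measurable_cauchyWeight : Measurable cauchyWeight :=
  contDiff_cauchyWeight.continuous.measurable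

theorem pi_withDensity_cauchyWeight :
    (Measure.pi fun _ : Fin d => volume.withDensity fun x => ENNReal.ofReal (cauchyWeight x)) =
      cauchyVecMeasure d := by
  refine Measure.pi_eq fun s hs => ?_
  have h0 : ∀ x : Fin d → ℝ, 0 ≤ ∏ k, cauchyWeight (x k) := fun x =>
    Finset.prod_nonneg fun k _ => (cauchyWeight_pos _).le
  rw [cauchyVecMeasure, withDensity_apply _ (MeasurableSet.univ_pi hs),
    ← ofReal_integral_eq_lintegral_ofReal integrable_prod_cauchyWeight.integrableOn
      (ae_of_all _ h0), volume_pi, Measure.restrict_pi_pi,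
    integral_fintype_prod_eq_prod (fun _ => cauchyWeight),
    ENNReal.ofReal_prod_of_nonneg fun k _ => integral_nonneg fun x => (cauchyWeight_pos x).le]
  refine Finset.prod_congr rfl fun k _ => ?_
  rw [withDensity_apply _ (hs k), ofReal_integral_eq_lintegral_ofReal
    integrable_cauchyWeight.integrableOn (ae_of_all _ fun x => (cauchyWeight_pos x).le)]

theorem measurePreserving_cotMapInvVec :
    MeasurePreserving cotMapInvVec (cauchyVecMeasure d) (cubeMeasure d) := by
  rw [← pi_withDensity_cauchyWeight]
  exact measurePreserving_pi _ _ fun _ => measurePreserving_cotMapInv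

/-- No measurability of `h` is needed, since the substitution is a measurable embedding. -/
theorem integral_cubeMeasure (h : (Fin d → ℝ) → ℝ) :
    ∫ t, h t ∂cubeMeasure d = ∫ x, (∏ k, cauchyWeight (x k)) * h (cotMapInvVec x) := by
  rw [← measurePreserving_cotMapInvVec.integral_comp measurableEmbedding_cotMapInvVec,
    cauchyVecMeasure, integral_withDensity_eq_integral_toReal_smul]
  · refine integral_congr_ae (ae_of_all _ fun x => ?_)
    simp only [smul_eq_mul]
    rw [ENNReal.toReal_ofReal (Finset.prod_nonneg fun k _ => (cauchyWeight_pos _).le)]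
  · exact (Finset.measurable_prod _ fun k _ =>
      measurable_cauchyWeight.comp (measurable_pi_apply k)).ennreal_ofReal
  · exact ae_of_all _ fun x => ENNReal.ofReal_lt_top

theorem ae_cubeMeasure_comp_cotMapVec {p : (Fin d → ℝ) → Prop}
    (h : ∀ᵐ x ∂(volume : Measure (Fin d → ℝ)), p x) : ∀ᵐ t ∂cubeMeasure d, p (cotMapVec t) := by
  rw [← measurePreserving_cotMapInvVec.map_eq, measurableEmbedding_cotMapInvVec.ae_map_iff]
  simp only [cotMapVec_cotMapInvVec]
  exact withDensity_absolutelyContinuous _ _ h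

theorem eLpNorm_comp_cotMapVec (u : (Fin d → ℝ) → ℝ) :
    eLpNorm (fun t => u (cotMapVec t)) 2 (cubeMeasure d) = eLpNorm u 2 (cauchyVecMeasure d) := by
  rw [← measurePreserving_cotMapInvVec.map_eq, measurableEmbedding_cotMapInvVec.eLpNorm_map_measure]
  simp only [Function.comp_def, cotMapVec_cotMapInvVec]

theorem aestronglyMeasurable_comp_cotMapVec {u : (Fin d → ℝ) → ℝ}
    (hu : AEStronglyMeasurable u volume) :
    AEStronglyMeasurable (fun t => u (cotMapVec t)) (cubeMeasure d) := by
  rw [← measurePreserving_cotMapInvVec.map_eq,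
    measurableEmbedding_cotMapInvVec.aestronglyMeasurable_map_iff]
  simp only [Function.comp_def, cotMapVec_cotMapInvVec]
  exact hu.mono_ac (withDensity_absolutelyContinuous _ _)

end CotSubstitution

/-! ### Coefficients of the transformed derivatives in one variable -/

section Coefficients

open Polynomial in
/-- The polynomials `p_{n,m}` with `(π (1 + x²) ∂)ⁿ (π (1 + x²) ρ u) = ∑ₘ p_{n,m} ρ ∂ᵐ u`
in dimension one. -/
def cotPoly : ℕ → ℕ → ℝ[X]
  | 0, 0 => C Real.pi * (1 + X ^ 2)
  | 0, _ + 1 => 0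
  | n + 1, 0 => C Real.pi * (1 + X ^ 2) * (derivative (cotPoly n 0) - X * cotPoly n 0)
  | n + 1, m + 1 => C Real.pi * (1 + X ^ 2) *
      (derivative (cotPoly n (m + 1)) - X * cotPoly n (m + 1) + cotPoly n m)

/-- After `n` differentiations at most `n` derivatives have fallen on the function. -/
theorem cotPoly_eq_zero : ∀ {n m : ℕ}, n < m → cotPoly n m = 0
  | 0, _ + 1, _ => by simp [cotPoly]
  | n + 1, m + 1, h => by
    simp [cotPoly, cotPoly_eq_zero (show n < m + 1 by omega),
      cotPoly_eq_zero (show n < m by omega)]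

/-- The one-dimensional Gaussian density. -/
def gaussDensityOne (x : ℝ) : ℝ := Real.exp (-x ^ 2 / 2) / Real.sqrt (2 * Real.pi)

theorem gaussDensityOne_pos (x : ℝ) : 0 < gaussDensityOne x := by
  unfold gaussDensityOne
  have := Real.pi_pos
  positivity

theorem gaussDensity_eq_prod {d : ℕ} (x : Fin d → ℝ) :
    gaussDensity x = ∏ k, gaussDensityOne (x k) := by
  have hp : 0 < 2 * Real.pi := by positivity
  unfold gaussDensity gaussDensityOne
  rw [Finset.prod_div_distrib, ← Real.exp_sum, Finset.prod_const, Finset.card_univ,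
    Fintype.card_fin, Real.sqrt_eq_rpow, ← Real.rpow_natCast, ← Real.rpow_mul hp.le]
  congr 2
  · rw [← Finset.sum_div, Finset.sum_neg_distrib]
  · ring

theorem gaussDensity_pos {d : ℕ} (x : Fin d → ℝ) : 0 < gaussDensity x := by
  rw [gaussDensity_eq_prod]
  exact Finset.prod_pos fun k _ => gaussDensityOne_pos _

theorem hasDerivAt_gaussDensityOne (x : ℝ) :
    HasDerivAt gaussDensityOne (-x * gaussDensityOne x) x := by
  have h1 : HasDerivAt (fun x : ℝ => -x ^ 2 / 2) (-x) x := by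
    have := ((hasDerivAt_pow 2 x).neg).div_const 2
    convert! this using 1
    simp
    ring
  have h2 := h1.exp.div_const (Real.sqrt (2 * Real.pi))
  convert! h2 using 1
  unfold gaussDensityOne
  ring

theorem contDiff_gaussDensityOne : ContDiff ℝ ∞ gaussDensityOne :=
  (Real.contDiff_exp.comp (by fun_prop)).div_const _

/-- The coefficient functions `p_{n,m} ρ`. -/
def cotCoeff (n m : ℕ) (x : ℝ) : ℝ := (cotPoly n m).eval x * gaussDensityOne x

/-- `cotCoeff n (m - 1)`, and `0` if `m = 0`. -/
def cotCoeffPred (n : ℕ) : ℕ → ℝ → ℝ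
  | 0, _ => 0
  | m + 1, x => cotCoeff n m x

theorem contDiff_cotCoeff (n m : ℕ) : ContDiff ℝ ∞ (cotCoeff n m) :=
  (by simpa using (cotPoly n m).contDiff_aeval (𝕜 := ℝ) ∞ :
    ContDiff ℝ ∞ fun x => (cotPoly n m).eval x).mul contDiff_gaussDensityOne

theorem cotCoeff_eq_zero {n m : ℕ} (h : n < m) : cotCoeff n m = 0 := by
  funext x
  simp [cotCoeff, cotPoly_eq_zero h]

/-- The recursion of `cotPoly` is made for this identity. It collects the coefficient of ∂ᵐu after
one more differentiation, using ρ' = -xρ; the factor `cauchyWeight x` converts ∂/∂t into ∂/∂x. -/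
theorem deriv_cotCoeff_add (n m : ℕ) (x : ℝ) :
    deriv (cotCoeff n m) x + cotCoeffPred n m x = cauchyWeight x * cotCoeff (n + 1) m x := by
  have h : deriv (cotCoeff n m) x = (Polynomial.derivative (cotPoly n m)).eval x *
      gaussDensityOne x + (cotPoly n m).eval x * (-x * gaussDensityOne x) :=
    (((cotPoly n m).hasDerivAt x).mul (hasDerivAt_gaussDensityOne x)).deriv
  have hp := Real.pi_pos
  have hx : 0 < 1 + x ^ 2 := by positivity
  rw [h]
  cases m with
  | zero =>
    simp only [cotCoeffPred, cotCoeff, cotPoly, cauchyWeight, Polynomial.eval_mul,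
      Polynomial.eval_C, Polynomial.eval_add, Polynomial.eval_one, Polynomial.eval_pow,
      Polynomial.eval_X, Polynomial.eval_sub]
    field_simp
    ring
  | succ m =>
    simp only [cotCoeffPred, cotCoeff, cotPoly, cauchyWeight, Polynomial.eval_mul,
      Polynomial.eval_C, Polynomial.eval_add, Polynomial.eval_one, Polynomial.eval_pow,
      Polynomial.eval_X, Polynomial.eval_sub]
    field_simp
    ring

/-- For monomials, |x|ᵏ ≤ k! e^{|x|} and |x| ≤ 1 + x²/4, the latter from (|x|/2 - 1)² ≥ 0. -/
theorem exists_bound_eval_mul_exp (p : Polynomial ℝ) :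
    ∃ B : ℝ, ∀ x : ℝ, |p.eval x| * Real.exp (-x ^ 2 / 4) ≤ B := by
  induction p using Polynomial.induction_on' with
  | add p q hp hq =>
    obtain ⟨B, hB⟩ := hp
    obtain ⟨B', hB'⟩ := hq
    refine ⟨B + B', fun x => ?_⟩
    rw [Polynomial.eval_add]
    calc |p.eval x + q.eval x| * Real.exp (-x ^ 2 / 4)
        ≤ (|p.eval x| + |q.eval x|) * Real.exp (-x ^ 2 / 4) :=
          mul_le_mul_of_nonneg_right (abs_add_le _ _) (Real.exp_pos _).le
      _ ≤ B + B' := by rw [add_mul]; exact add_le_add (hB x) (hB' x)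
  | monomial k a =>
    refine ⟨|a| * (k.factorial * Real.exp 1), fun x => ?_⟩
    rw [Polynomial.eval_monomial, abs_mul, abs_pow, mul_assoc]
    refine mul_le_mul_of_nonneg_left ?_ (abs_nonneg a)
    have h1 := Real.pow_div_factorial_le_exp |x| (abs_nonneg x) k
    rw [div_le_iff₀ (by positivity)] at h1
    have h2 : |x| ≤ 1 + x ^ 2 / 4 := by
      have := sq_nonneg (|x| / 2 - 1)
      nlinarith [sq_abs x]
    calc |x| ^ k * Real.exp (-x ^ 2 / 4)
        ≤ (Real.exp |x| * k.factorial) * Real.exp (-x ^ 2 / 4) :=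
          mul_le_mul_of_nonneg_right h1 (Real.exp_pos _).le
      _ = k.factorial * Real.exp (|x| + -x ^ 2 / 4) := by rw [Real.exp_add]; ring
      _ ≤ k.factorial * Real.exp 1 :=
          mul_le_mul_of_nonneg_left (Real.exp_le_exp.2 (by linarith)) (by positivity)

/-- Split ρ = √ρ · √ρ. One factor, a multiple of e^{-x²/4}, absorbs the polynomial together with π(1
+ x²); the other is kept for pairing with L²_ρ. -/
theorem exists_bound_cotCoeff (n m : ℕ) :
    ∃ B : ℝ, ∀ x, |cotCoeff n m x| ≤ B * (Real.sqrt (gaussDensityOne x) * cauchyWeight x) := by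
  obtain ⟨B, hB⟩ := exists_bound_eval_mul_exp
    (cotPoly n m * (Polynomial.C Real.pi * (1 + Polynomial.X ^ 2)))
  have hp := Real.pi_pos
  set c := Real.sqrt (2 * Real.pi) with hc
  have hc0 : 0 < c := by positivity
  refine ⟨B / Real.sqrt c, fun x => ?_⟩
  have hx : 0 < Real.pi * (1 + x ^ 2) := by positivity
  have hs : Real.sqrt (gaussDensityOne x) = Real.exp (-x ^ 2 / 4) / Real.sqrt c := by
    rw [gaussDensityOne, Real.sqrt_div (Real.exp_pos _).le, ← Real.exp_half]
    congr 2
    ring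
  have h1 := hB x
  simp only [Polynomial.eval_mul, Polynomial.eval_C, Polynomial.eval_add, Polynomial.eval_one,
    Polynomial.eval_pow, Polynomial.eval_X, abs_mul _ (Real.pi * (1 + x ^ 2)), abs_of_pos hx] at h1
  have hg : gaussDensityOne x =
      Real.sqrt (gaussDensityOne x) * Real.sqrt (gaussDensityOne x) :=
    (Real.mul_self_sqrt (gaussDensityOne_pos x).le).symm
  have h2 : |cotCoeff n m x| =
      (|(cotPoly n m).eval x| * (Real.pi * (1 + x ^ 2)) * Real.exp (-x ^ 2 / 4)) / Real.sqrt c *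
        (Real.sqrt (gaussDensityOne x) * cauchyWeight x) := by
    rw [cotCoeff, abs_mul, abs_of_pos (gaussDensityOne_pos x)]
    nth_rewrite 1 [hg]
    nth_rewrite 1 [hs]
    unfold cauchyWeight
    field_simp
  rw [h2]
  refine mul_le_mul_of_nonneg_right (div_le_div_of_nonneg_right h1 (Real.sqrt_nonneg _)) ?_
  exact mul_nonneg (Real.sqrt_nonneg _) (cauchyWeight_pos x).le

theorem exists_uniform_bound_cotCoeff (α : ℕ) :
    ∃ B : ℝ, 1 ≤ B ∧ ∀ n ≤ α, ∀ m ≤ α, ∀ x,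
      |cotCoeff n m x| ≤ B * (Real.sqrt (gaussDensityOne x) * cauchyWeight x) := by
  choose b hb using exists_bound_cotCoeff
  obtain ⟨M, hM⟩ := Finset.exists_le
    ((Finset.range (α + 1) ×ˢ Finset.range (α + 1)).image fun p => b p.1 p.2)
  refine ⟨max 1 M, le_max_left _ _, fun n hn m hm x => (hb n m x).trans ?_⟩
  refine mul_le_mul_of_nonneg_right (le_max_of_le_right (hM _ ?_))
    (mul_nonneg (Real.sqrt_nonneg _) (cauchyWeight_pos x).le)
  exact Finset.mem_image.2 ⟨(n, m), by simp; omega, rfl⟩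

end Coefficients

/-! ### The transformed derivatives on the whole space -/

section CotSum

variable {d : ℕ}

/-- The multi-indices in `{0,…,α}ᵈ`. -/
def multiIndexBox (d α : ℕ) : Finset (Fin d → ℕ) :=
  Fintype.piFinset fun _ : Fin d => Finset.range (α + 1)

theorem mem_multiIndexBox {α : ℕ} {s : Fin d → ℕ} : s ∈ multiIndexBox d α ↔ ∀ k, s k ≤ α := by
  simp [multiIndexBox]

/-- The coefficient of `D^s f` in the `r`-th derivative of the transformed function. -/
def cotCoeffVec (r s : Fin d → ℕ) (x : Fin d → ℝ) : ℝ := ∏ k, cotCoeff (r k) (s k) (x k)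

/-- The `r`-th derivative of the transformed function in the original variables. -/
def cotSum (α : ℕ) (F : (Fin d → ℕ) → (Fin d → ℝ) → ℝ) (r : Fin d → ℕ) (x : Fin d → ℝ) : ℝ :=
  ∑ s ∈ multiIndexBox d α, cotCoeffVec r s x * F s x

theorem contDiff_cotCoeffVec (r s : Fin d → ℕ) : ContDiff ℝ ∞ (cotCoeffVec r s) :=
  contDiff_prod fun k _ => (contDiff_cotCoeff _ _).comp (contDiff_apply ℝ ℝ k)

theorem partialDeriv_cotCoeffVec (r s : Fin d → ℕ) (ℓ : Fin d) (x : Fin d → ℝ) :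
    partialDeriv ℓ (cotCoeffVec r s) x = deriv (cotCoeff (r ℓ) (s ℓ)) (x ℓ) *
      ∏ k ∈ Finset.univ.erase ℓ, cotCoeff (r k) (s k) (x k) := by
  refine partialDeriv_eq_of_hasDerivAt
    ((contDiff_cotCoeffVec r s).differentiable (by simp)).differentiableAt ?_
  have h : (fun t => cotCoeffVec r s (Function.update x ℓ t)) = fun t =>
      cotCoeff (r ℓ) (s ℓ) t * ∏ k ∈ Finset.univ.erase ℓ, cotCoeff (r k) (s k) (x k) := by
    funext t
    rw [cotCoeffVec, ← Finset.mul_prod_erase _ _ (Finset.mem_univ ℓ), Function.update_self]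
    congr 1
    refine Finset.prod_congr rfl fun k hk => ?_
    rw [Function.update_of_ne (Finset.ne_of_mem_erase hk)]
  rw [h]
  exact ((contDiff_cotCoeff _ _).differentiable (by simp)).differentiableAt.hasDerivAt.mul_const _

theorem prod_erase_cotCoeff_congr {r s r' s' : Fin d → ℕ} {ℓ : Fin d} (x : Fin d → ℝ)
    (hr : ∀ k, k ≠ ℓ → r k = r' k) (hs : ∀ k, k ≠ ℓ → s k = s' k) :
    ∏ k ∈ Finset.univ.erase ℓ, cotCoeff (r k) (s k) (x k) =
      ∏ k ∈ Finset.univ.erase ℓ, cotCoeff (r' k) (s' k) (x k) :=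
  Finset.prod_congr rfl fun k hk => by
    rw [hr k (Finset.ne_of_mem_erase hk), hs k (Finset.ne_of_mem_erase hk)]

theorem cauchyWeight_mul_cotCoeffVec (r s : Fin d → ℕ) (ℓ : Fin d) (x : Fin d → ℝ) :
    cauchyWeight (x ℓ) * cotCoeffVec (r + Pi.single ℓ 1) s x =
      partialDeriv ℓ (cotCoeffVec r s) x + cotCoeffPred (r ℓ) (s ℓ) (x ℓ) *
        ∏ k ∈ Finset.univ.erase ℓ, cotCoeff (r k) (s k) (x k) := by
  rw [partialDeriv_cotCoeffVec, ← add_mul, deriv_cotCoeff_add, cotCoeffVec,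
    ← Finset.mul_prod_erase _ _ (Finset.mem_univ ℓ), mul_assoc,
    prod_erase_cotCoeff_congr (r := r + Pi.single ℓ 1) (r' := r) x
      (fun k hk => by simp [hk]) (fun _ _ => rfl)]
  simp

/-- Index shift s ↦ s + e_ℓ. Terms with s_ℓ = 0 drop out on the left by the default value of
`cotCoeffPred`; the condition s_ℓ < α keeps the shifted index in the box. -/
theorem sum_cotCoeffPred {α : ℕ} (F : (Fin d → ℕ) → (Fin d → ℝ) → ℝ) (r : Fin d → ℕ)
    (ℓ : Fin d) (x : Fin d → ℝ) :
    ∑ s ∈ multiIndexBox d α, cotCoeffPred (r ℓ) (s ℓ) (x ℓ) *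
        (∏ k ∈ Finset.univ.erase ℓ, cotCoeff (r k) (s k) (x k)) * F s x =
      ∑ s ∈ multiIndexBox d α with s ℓ < α, cotCoeffVec r s x * F (s + Pi.single ℓ 1) x := by
  rw [← Finset.sum_filter_of_ne (s := multiIndexBox d α) (p := fun s : Fin d → ℕ => s ℓ ≠ 0)]
  · symm
    refine Finset.sum_nbij' (fun s => s + Pi.single ℓ 1) (fun s => s - Pi.single ℓ 1) ?_ ?_ ?_ ?_ ?_
    · intro s hs
      rw [Finset.mem_filter, mem_multiIndexBox] at hs
      rw [Finset.mem_filter, mem_multiIndexBox]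
      refine ⟨fun k => ?_, by simp⟩
      by_cases h : k = ℓ
      · subst h; simpa using hs.2
      · simpa [h] using hs.1 k
    · intro s hs
      rw [Finset.mem_filter, mem_multiIndexBox] at hs
      rw [Finset.mem_filter, mem_multiIndexBox]
      refine ⟨fun k => (Nat.sub_le _ _).trans (hs.1 k), ?_⟩
      have := hs.1 ℓ
      have := hs.2
      simp only [Pi.sub_apply, Pi.single_eq_same]
      omega
    · intro s _
      exact add_tsub_cancel_right _ _
    · intro s hs
      refine tsub_add_cancel_of_le fun k => ?_
      by_cases h : k = ℓ
      · subst h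
        simpa using Nat.one_le_iff_ne_zero.2 (Finset.mem_filter.1 hs).2
      · simp [h]
    · intro s _
      simp only [Pi.add_apply, Pi.single_eq_same, cotCoeffPred]
      rw [cotCoeffVec, ← Finset.mul_prod_erase _ _ (Finset.mem_univ ℓ)]
      congr 2
      exact prod_erase_cotCoeff_congr (r := r) (r' := r) (s := s) (s' := s + Pi.single ℓ 1)
        (ℓ := ℓ) x (fun _ _ => rfl)
        (fun k hk => by simp [hk])
  · intro s _ hne h0
    exact hne (by simp [h0, cotCoeffPred])

/-- Leibniz rule term by term. Terms with s_ℓ = α have coefficient zero because r_ℓ < α, so no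
derivative of `f` of order α + 1 in direction ℓ is ever needed. -/
theorem isWeakPartial_cotSum {α : ℕ} {F : (Fin d → ℕ) → (Fin d → ℝ) → ℝ} {r : Fin d → ℕ}
    {ℓ : Fin d} (hr : r ℓ < α)
    (hloc : ∀ s ∈ multiIndexBox d α, LocallyIntegrable (F s) volume)
    (hF : ∀ s ∈ multiIndexBox d α, s ℓ < α →
      IsWeakPartial ℓ (F s) (F (s + Pi.single ℓ 1))) :
    IsWeakPartial ℓ (cotSum α F r)
      (fun x => cauchyWeight (x ℓ) * cotSum α F (r + Pi.single ℓ 1) x) := by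
  have hzero : ∀ s ∈ multiIndexBox d α, ¬ s ℓ < α → cotCoeff (r ℓ) (s ℓ) = 0 := fun s _ h' =>
    cotCoeff_eq_zero (by omega)
  have h1 : cotSum α F r = fun x => ∑ s ∈ multiIndexBox d α with s ℓ < α,
      cotCoeffVec r s x * F s x := by
    funext x
    rw [cotSum, Finset.sum_filter_of_ne]
    intro s hs hne
    by_contra h
    refine hne ?_
    rw [cotCoeffVec, Finset.prod_eq_zero (Finset.mem_univ ℓ) (by rw [hzero s hs h]; rfl), zero_mul]
  have h2 : (fun x => cauchyWeight (x ℓ) * cotSum α F (r + Pi.single ℓ 1) x) = fun x =>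
      ∑ s ∈ multiIndexBox d α with s ℓ < α, (partialDeriv ℓ (cotCoeffVec r s) x * F s x +
        cotCoeffVec r s x * F (s + Pi.single ℓ 1) x) := by
    funext x
    rw [cotSum, Finset.mul_sum, Finset.sum_add_distrib, ← sum_cotCoeffPred,
      Finset.sum_filter_of_ne, ← Finset.sum_add_distrib]
    · refine Finset.sum_congr rfl fun s _ => ?_
      rw [← mul_assoc, cauchyWeight_mul_cotCoeffVec, add_mul]
    · intro s hs hne
      by_contra h
      refine hne ?_
      rw [partialDeriv_cotCoeffVec, hzero s hs h]
      simp
  have hmem : ∀ s ∈ (multiIndexBox d α).filter (fun s => s ℓ < α),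
      s + Pi.single ℓ 1 ∈ multiIndexBox d α := by
    intro s hs
    rw [Finset.mem_filter, mem_multiIndexBox] at hs
    rw [mem_multiIndexBox]
    intro k
    by_cases h : k = ℓ
    · subst h; simpa using hs.2
    · simpa [h] using hs.1 k
  rw [h1, h2]
  refine IsWeakPartial.sum (fun s hs => ?_) (fun s hs => ?_) (fun s hs => ?_)
  · exact (hF s (Finset.mem_filter.1 hs).1 (Finset.mem_filter.1 hs).2).mul
      (hloc _ (Finset.mem_filter.1 hs).1) (hloc _ (hmem s hs)) (contDiff_cotCoeffVec r s)
  · exact LocallyIntegrable.mul_continuous (hloc _ (Finset.mem_filter.1 hs).1)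
      (contDiff_cotCoeffVec r s).continuous
  · exact (LocallyIntegrable.mul_continuous (hloc _ (Finset.mem_filter.1 hs).1)
      ((contDiff_cotCoeffVec r s).partialDeriv ℓ).continuous).add
      (LocallyIntegrable.mul_continuous (hloc _ (hmem s hs)) (contDiff_cotCoeffVec r s).continuous)

theorem prod_cauchyWeight_mem (x : Fin d → ℝ) : (∏ k, cauchyWeight (x k)) ∈ Ioc (0 : ℝ) 1 :=
  ⟨Finset.prod_pos fun _ _ => cauchyWeight_pos _,
    Finset.prod_le_one (fun _ _ => (cauchyWeight_pos _).le) fun _ _ => cauchyWeight_le_one _⟩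

theorem abs_cotCoeffVec_le {α : ℕ} {B : ℝ}
    (hB : ∀ n ≤ α, ∀ m ≤ α, ∀ x,
      |cotCoeff n m x| ≤ B * (Real.sqrt (gaussDensityOne x) * cauchyWeight x))
    {r s : Fin d → ℕ} (hr : ∀ k, r k ≤ α) (hs : ∀ k, s k ≤ α) (x : Fin d → ℝ) :
    |cotCoeffVec r s x| ≤
      B ^ d * (Real.sqrt (gaussDensity x) * ∏ k, cauchyWeight (x k)) := by
  have h : Real.sqrt (gaussDensity x) = ∏ k, Real.sqrt (gaussDensityOne (x k)) := by
    rw [gaussDensity_eq_prod, Real.sqrt_eq_iff_mul_self_eq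
      (Finset.prod_nonneg fun k _ => (gaussDensityOne_pos _).le)
      (Finset.prod_nonneg fun k _ => Real.sqrt_nonneg _), ← Finset.prod_mul_distrib]
    exact Finset.prod_congr rfl fun k _ =>
      (Real.mul_self_sqrt (gaussDensityOne_pos _).le).symm
  have hc : B ^ d = ∏ _k : Fin d, B := by simp
  rw [cotCoeffVec, Finset.abs_prod, h, hc, ← Finset.prod_mul_distrib, ← Finset.prod_mul_distrib]
  exact Finset.prod_le_prod (fun k _ => abs_nonneg _) fun k _ => hB _ (hr k) _ (hs k) _

theorem measurable_gaussDensity : Measurable (gaussDensity (d := d)) := by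
  unfold gaussDensity
  fun_prop

/-- With W the product of the weights, the term is at most Bᵈ |u| √ρ W ≤ Bᵈ (u²ρ + W), because W ≤
1; both summands are integrable. -/
theorem integrable_cotCoeffVec_mul {α : ℕ} {u : (Fin d → ℝ) → ℝ} (hu : LocallyIntegrable u volume)
    (hu2 : MemLp u 2 (gaussMeasure d)) {r s : Fin d → ℕ} (hr : ∀ k, r k ≤ α)
    (hs : ∀ k, s k ≤ α) : Integrable (fun x => cotCoeffVec r s x * u x) volume := by
  obtain ⟨B, hB1, hB⟩ := exists_uniform_bound_cotCoeff α
  have h1 : Integrable (fun x => u x ^ 2 * gaussDensity x) volume := by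
    have hms : AEStronglyMeasurable u (gaussMeasure d) := hu2.aestronglyMeasurable
    have := (memLp_two_iff_integrable_sq hms).1 hu2
    rw [gaussMeasure, integrable_withDensity_iff measurable_gaussDensity.ennreal_ofReal
      (ae_of_all _ fun x => ENNReal.ofReal_lt_top)] at this
    refine this.congr (ae_of_all _ fun x => ?_)
    simp only [ENNReal.toReal_ofReal (gaussDensity_pos x).le]
  refine Integrable.mono' ((h1.add integrable_prod_cauchyWeight).const_mul (B ^ d))
    ((contDiff_cotCoeffVec r s).continuous.aestronglyMeasurable.mul hu.aestronglyMeasurable)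
    (ae_of_all _ fun x => ?_)
  rw [norm_mul, Real.norm_eq_abs, Real.norm_eq_abs]
  have hW := prod_cauchyWeight_mem x
  have hsq := Real.mul_self_sqrt (gaussDensity_pos x).le
  calc |cotCoeffVec r s x| * |u x|
      ≤ B ^ d * (Real.sqrt (gaussDensity x) * ∏ k, cauchyWeight (x k)) * |u x| :=
        mul_le_mul_of_nonneg_right (abs_cotCoeffVec_le hB hr hs x) (abs_nonneg _)
    _ = B ^ d * ((|u x| * Real.sqrt (gaussDensity x)) * ∏ k, cauchyWeight (x k)) := by ring
    _ ≤ B ^ d * (u x ^ 2 * gaussDensity x + ∏ k, cauchyWeight (x k)) := by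
        refine mul_le_mul_of_nonneg_left ?_ (by positivity)
        have e : u x ^ 2 * gaussDensity x = (|u x| * Real.sqrt (gaussDensity x)) ^ 2 := by
          rw [mul_pow, sq_abs, sq (Real.sqrt _), hsq]
        rw [e]
        nlinarith [hW.1, hW.2,
          sq_nonneg (|u x| * Real.sqrt (gaussDensity x) - ∏ k, cauchyWeight (x k)),
          mul_nonneg hW.1.le (sub_nonneg.2 hW.2)]

/-- Pointwise comparison of densities: the squared coefficient times the product of the weights is
at most B²ᵈ ρ. -/
theorem eLpNorm_cotCoeffVec_mul_le {α : ℕ} {B : ℝ} (hB1 : 1 ≤ B)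
    (hB : ∀ n ≤ α, ∀ m ≤ α, ∀ x,
      |cotCoeff n m x| ≤ B * (Real.sqrt (gaussDensityOne x) * cauchyWeight x))
    {r s : Fin d → ℕ} (hr : ∀ k, r k ≤ α) (hs : ∀ k, s k ≤ α) (u : (Fin d → ℝ) → ℝ) :
    eLpNorm (fun x => cotCoeffVec r s x * u x) 2 (cauchyVecMeasure d) ≤
      ENNReal.ofReal (B ^ d) * eLpNorm u 2 (gaussMeasure d) := by
  have hB0 : 0 ≤ B ^ d := by positivity
  have hpt : ∀ x, ENNReal.ofReal (∏ k, cauchyWeight (x k)) * ‖cotCoeffVec r s x * u x‖ₑ ^ (2 : ℝ) ≤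
      ENNReal.ofReal (B ^ d) ^ (2 : ℝ) * (ENNReal.ofReal (gaussDensity x) * ‖u x‖ₑ ^ (2 : ℝ)) := by
    intro x
    have hW := prod_cauchyWeight_mem x
    rw [enorm_mul, ENNReal.mul_rpow_of_nonneg _ _ two_pos.le, ← mul_assoc, ← mul_assoc]
    refine mul_le_mul_left ?_ _
    rw [Real.enorm_eq_ofReal_abs, ENNReal.ofReal_rpow_of_nonneg (abs_nonneg _) two_pos.le,
      ENNReal.ofReal_rpow_of_nonneg hB0 two_pos.le, ← ENNReal.ofReal_mul hW.1.le,
      ← ENNReal.ofReal_mul (by positivity)]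
    refine ENNReal.ofReal_le_ofReal ?_
    rw [Real.rpow_two, Real.rpow_two]
    have h1 := pow_le_pow_left₀ (abs_nonneg _) (abs_cotCoeffVec_le hB hr hs x) 2
    rw [mul_pow, mul_pow, Real.sq_sqrt (gaussDensity_pos x).le] at h1
    have hg := (gaussDensity_pos x).le
    calc (∏ k, cauchyWeight (x k)) * |cotCoeffVec r s x| ^ 2 ≤ 1 * |cotCoeffVec r s x| ^ 2 :=
          mul_le_mul_of_nonneg_right hW.2 (sq_nonneg _)
      _ ≤ (B ^ d) ^ 2 * (gaussDensity x * (∏ k, cauchyWeight (x k)) ^ 2) := by rwa [one_mul]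
      _ ≤ (B ^ d) ^ 2 * (gaussDensity x * 1) := by
          gcongr
          exact pow_le_one₀ hW.1.le hW.2
      _ = _ := by rw [mul_one]
  rw [eLpNorm_eq_lintegral_rpow_enorm_toReal two_ne_zero ENNReal.ofNat_ne_top,
    eLpNorm_eq_lintegral_rpow_enorm_toReal two_ne_zero ENNReal.ofNat_ne_top, ENNReal.toReal_ofNat,
    cauchyVecMeasure, gaussMeasure,
    lintegral_withDensity_eq_lintegral_mul_non_measurable _ ?_ (ae_of_all _ fun x =>
      ENNReal.ofReal_lt_top), lintegral_withDensity_eq_lintegral_mul_non_measurable _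
      measurable_gaussDensity.ennreal_ofReal (ae_of_all _ fun x => ENNReal.ofReal_lt_top)]
  · have h2 : ENNReal.ofReal (B ^ d) = (ENNReal.ofReal (B ^ d) ^ (2 : ℝ)) ^ (1 / 2 : ℝ) := by
      rw [← ENNReal.rpow_mul]; norm_num
    rw [h2, ← ENNReal.mul_rpow_of_nonneg _ _ (by norm_num)]
    refine ENNReal.rpow_le_rpow ?_ (by norm_num)
    rw [← lintegral_const_mul' _ _ (by finiteness)]
    exact lintegral_mono hpt
  · exact (Finset.measurable_prod _ fun k _ =>
      measurable_cauchyWeight.comp (measurable_pi_apply k)).ennreal_ofReal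

/-- The source of the vanishing boundary values: φ need not vanish on the boundary of the cube.
After substitution its counterpart on ℝᵈ is merely bounded, which suffices because the sums are
integrable. -/
theorem integral_cotSum_mul_partialDeriv {α : ℕ} {F : (Fin d → ℕ) → (Fin d → ℝ) → ℝ}
    (hloc : ∀ s ∈ multiIndexBox d α, LocallyIntegrable (F s) volume)
    (hL2 : ∀ s ∈ multiIndexBox d α, MemLp (F s) 2 (gaussMeasure d))
    (hF : ∀ s ∈ multiIndexBox d α, ∀ ℓ, s ℓ < α →
      IsWeakPartial ℓ (F s) (F (s + Pi.single ℓ 1)))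
    {r : Fin d → ℕ} (hr : ∀ k, r k ≤ α) {ℓ : Fin d} (hℓ : r ℓ < α) {φ : (Fin d → ℝ) → ℝ}
    (hφ : ContDiff ℝ ∞ φ) (hc : HasCompactSupport φ) :
    ∫ t, cotSum α F r (cotMapVec t) * partialDeriv ℓ φ t ∂cubeMeasure d =
      -∫ t, cotSum α F (r + Pi.single ℓ 1) (cotMapVec t) * φ t ∂cubeMeasure d := by
  have hint : ∀ r : Fin d → ℕ, (∀ k, r k ≤ α) → Integrable (cotSum α F r) volume := fun r hr =>
    integrable_finsetSum _ fun s hs =>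
      integrable_cotCoeffVec_mul (hloc s hs) (hL2 s hs) hr (mem_multiIndexBox.1 hs)
  have hr' : ∀ k, (r + Pi.single ℓ 1 : Fin d → ℕ) k ≤ α := by
    intro k
    by_cases h : k = ℓ
    · subst h; simpa using hℓ
    · simpa [h] using hr k
  have hwp := isWeakPartial_cotSum hℓ hloc fun s hs h => hF s hs ℓ h
  -- The density of the substitution with its ℓ-th factor left out. The chain rule supplies that
  -- factor in ∂ₗχ, and `isWeakPartial_cotSum` supplies it on the other side.
  set χ : (Fin d → ℝ) → ℝ := fun x =>
    φ (cotMapInvVec x) * ∏ k ∈ Finset.univ.erase ℓ, cauchyWeight (x k) with hχ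
  have hχs : ContDiff ℝ ∞ χ := (hφ.comp contDiff_cotMapInvVec).mul
    (contDiff_prod fun k _ => contDiff_cauchyWeight.comp (contDiff_apply ℝ ℝ k))
  have hχ' : ∀ x, partialDeriv ℓ χ x =
      (∏ k, cauchyWeight (x k)) * partialDeriv ℓ φ (cotMapInvVec x) := by
    intro x
    refine partialDeriv_eq_of_hasDerivAt (hχs.differentiable (by simp)).differentiableAt ?_
    have he : (fun s => χ (Function.update x ℓ s)) = fun s =>
        φ (Function.update (cotMapInvVec x) ℓ (cotMapInv s)) *
          ∏ k ∈ Finset.univ.erase ℓ, cauchyWeight (x k) := by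
      funext s
      have e1 : cotMapInvVec (Function.update x ℓ s) =
          Function.update (cotMapInvVec x) ℓ (cotMapInv s) := by
        funext k
        by_cases h : k = ℓ
        · subst h; simp [cotMapInvVec]
        · simp [cotMapInvVec, h]
      simp only [hχ, e1]
      refine congrArg _ (Finset.prod_congr rfl fun k hk => ?_)
      rw [Function.update_of_ne (Finset.ne_of_mem_erase hk)]
    rw [he]
    have h1 := hasDerivAt_comp_update ℓ (cotMapInvVec x) (cotMapInv (x ℓ))
      (hφ.differentiable (by simp)).differentiableAt
    have h2 := (h1.comp (x ℓ) (hasDerivAt_cotMapInv (x ℓ))).mul_const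
      (∏ k ∈ Finset.univ.erase ℓ, cauchyWeight (x k))
    have h3 : Function.update (cotMapInvVec x) ℓ (cotMapInv (x ℓ)) = cotMapInvVec x :=
      Function.update_eq_self ℓ (cotMapInvVec x)
    rw [h3] at h2
    convert! h2 using 1
    rw [← Finset.mul_prod_erase _ _ (Finset.mem_univ ℓ)]
    ring
  obtain ⟨K, hK⟩ := hφ.continuous.bounded_above_of_compact_support hc
  obtain ⟨K', hK'⟩ := (hφ.partialDeriv ℓ).continuous.bounded_above_of_compact_support
    (hc.partialDeriv ℓ)
  have hv : Integrable (fun x => cauchyWeight (x ℓ) * cotSum α F (r + Pi.single ℓ 1) x)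
      volume := by
    refine (hint _ hr').bdd_mul (c := 1)
      (contDiff_cauchyWeight.continuous.comp (continuous_apply ℓ)).aestronglyMeasurable
      (ae_of_all _ fun x => ?_)
    rw [Real.norm_eq_abs, abs_of_pos (cauchyWeight_pos _)]
    exact cauchyWeight_le_one _
  have key := hwp.integral_eq_of_bounded (B := max K K') (hint r hr) hv hχs (fun x => ?_)
    (fun x => ?_)
  · rw [integral_cubeMeasure, integral_cubeMeasure]
    simp only [cotMapVec_cotMapInvVec]
    convert! key using 1
    · refine integral_congr_ae (ae_of_all _ fun x => ?_)
      simp only [hχ']; ring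
    · congr 1
      refine integral_congr_ae (ae_of_all _ fun x => ?_)
      simp only [hχ]
      rw [← Finset.mul_prod_erase _ _ (Finset.mem_univ ℓ)]
      ring
  · have h1 : 0 ≤ ∏ k ∈ Finset.univ.erase ℓ, cauchyWeight (x k) :=
      Finset.prod_nonneg fun k _ => (cauchyWeight_pos _).le
    rw [hχ, abs_mul, abs_of_nonneg h1]
    refine (mul_le_of_le_one_right (abs_nonneg _) ?_).trans (le_max_of_le_left (hK _))
    exact Finset.prod_le_one (fun k _ => (cauchyWeight_pos _).le) fun k _ => cauchyWeight_le_one _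
  · have hW := prod_cauchyWeight_mem x
    rw [hχ', abs_mul, abs_of_pos hW.1]
    exact (mul_le_of_le_one_left (abs_nonneg _) hW.2).trans (le_max_of_le_right (hK' _))

end CotSum

/-! ### From integration by parts on the cube to primitives -/

section CubePartial

variable {d : ℕ}

/-- `v` is the weak partial derivative `∂ₗ u` on the unit cube, tested against functions that need
not vanish on the boundary of the cube; thus `u` has zero trace on the faces orthogonal to `eₗ`. -/
def IsCubePartial (ℓ : Fin d) (u v : (Fin d → ℝ) → ℝ) : Prop :=
  ∀ φ : (Fin d → ℝ) → ℝ, ContDiff ℝ ∞ φ → HasCompactSupport φ →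
    ∫ t, u t * partialDeriv ℓ φ t ∂cubeMeasure d = -∫ t, v t * φ t ∂cubeMeasure d

theorem integrable_cubeMeasure_mul {u φ : (Fin d → ℝ) → ℝ} (hu : Integrable u (cubeMeasure d))
    (hφ : Continuous φ) (hc : HasCompactSupport φ) :
    Integrable (fun t => u t * φ t) (cubeMeasure d) := by
  obtain ⟨K, hK⟩ := hφ.bounded_above_of_compact_support hc
  exact hu.mul_bdd hφ.aestronglyMeasurable (ae_of_all _ hK)

theorem ae_eq_of_integral_mul_eq {u v : (Fin d → ℝ) → ℝ} (hu : Integrable u (cubeMeasure d))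
    (hv : Integrable v (cubeMeasure d))
    (h : ∀ φ : (Fin d → ℝ) → ℝ, ContDiff ℝ ∞ φ → HasCompactSupport φ → tsupport φ ⊆ unitCube d →
      ∫ t, u t * φ t ∂cubeMeasure d = ∫ t, v t * φ t ∂cubeMeasure d) :
    u =ᵐ[cubeMeasure d] v := by
  have hi : Integrable (fun t => u t - v t) (cubeMeasure d) := hu.sub hv
  have key : ∀ᵐ t ∂(volume : Measure (Fin d → ℝ)), t ∈ unitCube d → u t - v t = 0 := by
    refine isOpen_unitCube.ae_eq_zero_of_integral_contDiff_smul_eq_zero ?_ ?_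
    · rw [← volume_restrict_unitCube] at hi
      exact IntegrableOn.locallyIntegrableOn hi
    · intro φ hφ hc hs
      have h1 : ∫ t in unitCube d, φ t • (u t - v t) = ∫ t, φ t • (u t - v t) := by
        refine setIntegral_eq_integral_of_forall_compl_eq_zero fun t ht => ?_
        rw [image_eq_zero_of_notMem_tsupport fun h => ht (hs h), zero_smul]
      rw [← h1, volume_restrict_unitCube]
      have h2 := h φ hφ hc hs
      rw [← sub_eq_zero, ← integral_sub (integrable_cubeMeasure_mul hu hφ.continuous hc)
        (integrable_cubeMeasure_mul hv hφ.continuous hc)] at h2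
      rw [← h2]
      refine integral_congr_ae (ae_of_all _ fun t => ?_)
      simp only [smul_eq_mul]; ring
  rw [← volume_restrict_unitCube]
  rw [EventuallyEq, ae_restrict_iff' isOpen_unitCube.measurableSet]
  filter_upwards [key] with t ht ht'
  exact sub_eq_zero.1 (ht ht')

/-- The endpoint `c` is exempted because `A` may be a closed half-line starting at `c`. -/
theorem setIntegral_indicator_eq_intervalIntegral {h : ℝ → ℝ} (hh : ∀ s, s ∉ Ioo (0 : ℝ) 1 → h s = 0)
    {A : Set ℝ} {c e : ℝ} (hce : c ≤ e)
    (hA : ∀ s ∈ Ioo (0 : ℝ) 1, s ≠ c → (s ∈ A ↔ s ∈ Ioc c e)) :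
    ∫ s in Ioo 0 1, A.indicator h s = ∫ s in c..e, h s := by
  rw [intervalIntegral.integral_of_le hce, ← integral_indicator measurableSet_Ioo,
    ← integral_indicator measurableSet_Ioc]
  refine integral_congr_ae ?_
  filter_upwards [Measure.ae_ne volume c] with s hs
  by_cases h1 : s ∈ Ioo (0 : ℝ) 1
  · rw [indicator_of_mem h1]
    by_cases h2 : s ∈ A
    · rw [indicator_of_mem h2, indicator_of_mem ((hA s h1 hs).1 h2)]
    · rw [indicator_of_notMem h2, indicator_of_notMem (mt (hA s h1 hs).2 h2)]
  · simp [indicator, hh s h1]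

/-- The adjoint of integration in one variable is a segment integral, since φ vanishes outside the
cube. Two cases are used: `T = {ℓ}` with the segment from 0 to 1, and `T = ∅` with the segment from
-1 to 1. -/
theorem integral_partialIntegral_singleton {T : Finset (Fin d)} {ℓ : Fin d} (hT : T ⊆ {ℓ})
    {v φ : (Fin d → ℝ) → ℝ} (hv : Integrable v (cubeMeasure d)) (hφ : ContDiff ℝ ∞ φ)
    (hc : HasCompactSupport φ) (hs : tsupport φ ⊆ unitCube d) {a b : ℝ} (hab : a ≤ b)
    (hT' : ∀ τ ∈ Ioo (0 : ℝ) 1, ∀ s ∈ Ioo (0 : ℝ) 1, s ≠ τ + a →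
      ((∀ k ∈ T, k = ℓ → τ ≤ s) ↔ s ∈ Ioc (τ + a) (τ + b))) :
    ∫ t, partialIntegral (fun _ => volume.restrict (Ioo 0 1)) {ℓ} T v t * φ t ∂cubeMeasure d =
      ∫ t, v t * segmentIntegral ℓ a b φ t ∂cubeMeasure d := by
  obtain ⟨K, hK⟩ := hφ.continuous.bounded_above_of_compact_support hc
  rw [integral_partialIntegral_mul hT hv hφ.continuous.measurable hK]
  refine integral_congr_ae ?_
  filter_upwards [ae_mem_unitCube] with t ht
  congr 1
  set h : ℝ → ℝ := fun s => φ (Function.update t ℓ s) with hh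
  have hcont : Continuous h := hφ.continuous.comp (continuous_const.update ℓ continuous_id)
  set A : Set ℝ := {s | ∀ k ∈ T, k = ℓ → t ℓ ≤ s} with hA
  have hAm : MeasurableSet A := by
    by_cases hℓ : ℓ ∈ T
    · have : A = Ici (t ℓ) := by
        ext s
        exact ⟨fun h' => h' ℓ hℓ rfl, fun h' _ _ _ => h'⟩
      rw [this]; exact measurableSet_Ici
    · have : A = univ := eq_univ_of_forall fun s k hk hk' => absurd (hk' ▸ hk) hℓ
      rw [this]; exact MeasurableSet.univ
  have h1 : ∀ b : Fin d → ℝ, {b : Fin d → ℝ | ∀ k ∈ T, t k ≤ b k}.indicator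
      (fun b => φ (Finset.piecewise {ℓ} b t)) b = A.indicator h (b ℓ) := by
    intro b
    have h2 : (∀ k ∈ T, t k ≤ b k) ↔ ∀ k ∈ T, k = ℓ → t ℓ ≤ b ℓ := by
      refine forall₂_congr fun k hk => ?_
      have := Finset.mem_singleton.1 (hT hk)
      subst this
      simp
    simp only [indicator, mem_ofPred_eq, h2, hA, hh, Finset.piecewise_singleton]
  simp only [h1]
  rw [integral_comp_eval (μ := fun _ : Fin d => (volume : Measure ℝ).restrict (Ioo 0 1))
    (hcont.aestronglyMeasurable.indicator hAm),
    setIntegral_indicator_eq_intervalIntegral (h := h) (A := A) (c := t ℓ + a) (e := t ℓ + b) ?_ (by linarith)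
      fun s hs1 hs2 => hT' (t ℓ) (ht ℓ) s hs1 hs2]
  · rw [segmentIntegral, ← intervalIntegral.integral_comp_add_left]
  · intro s hs'
    refine image_eq_zero_of_notMem_tsupport (f := φ) fun h' => hs' ?_
    simpa using hs h' ℓ

/-- Test with the integral of φ over the segment from 0 to 1: its ∂ₗ is φ(t + eₗ) - φ(t), which
equals -φ(t) on the cube. This test function need not vanish on the face t_ℓ = 0. -/
theorem IsCubePartial.ae_eq_partialIntegral {ℓ : Fin d} {u v : (Fin d → ℝ) → ℝ}
    (h : IsCubePartial ℓ u v) (hu : Integrable u (cubeMeasure d))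
    (hv : Integrable v (cubeMeasure d)) :
    u =ᵐ[cubeMeasure d] partialIntegral (fun _ => volume.restrict (Ioo 0 1)) {ℓ} {ℓ} v := by
  refine ae_eq_of_integral_mul_eq hu (integrable_partialIntegral hv) fun φ hφ hc hs => ?_
  rw [integral_partialIntegral_singleton subset_rfl hv hφ hc hs zero_le_one ?_]
  · have h1 := h _ (contDiff_segmentIntegral ℓ zero_le_one hφ hc)
      (hasCompactSupport_segmentIntegral ℓ 0 1 hc)
    rw [← neg_inj, ← h1, ← integral_neg]
    refine integral_congr_ae ?_
    filter_upwards [ae_mem_unitCube] with t ht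
    have h2 : φ (Function.update t ℓ (t ℓ + 1)) = 0 := by
      refine image_eq_zero_of_notMem_tsupport fun h' => ?_
      have := (hs h' ℓ).2
      rw [Function.update_self] at this
      linarith [(ht ℓ).1]
    rw [partialDeriv_segmentIntegral ℓ zero_le_one hφ hc, h2, add_zero, Function.update_eq_self]
    ring
  · intro τ hτ s hs1 hne
    rw [add_zero] at hne ⊢
    simp only [Finset.mem_singleton, forall_eq, forall_const, mem_Ioc]
    exact ⟨fun h' => ⟨lt_of_le_of_ne h' hne.symm, by linarith [hτ.1, hs1.2]⟩, fun h' => h'.1.le⟩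

/-- Test with the integral of φ over the segment from -1 to 1: on the cube it does not depend on
t_ℓ, so the side containing `u` disappears. -/
theorem IsCubePartial.partialIntegral_ae_eq_zero {ℓ : Fin d} {u v : (Fin d → ℝ) → ℝ}
    (h : IsCubePartial ℓ u v) (hv : Integrable v (cubeMeasure d)) :
    partialIntegral (fun _ => volume.restrict (Ioo 0 1)) {ℓ} ∅ v =ᵐ[cubeMeasure d] 0 := by
  refine ae_eq_of_integral_mul_eq (integrable_partialIntegral hv) (integrable_zero _ _ _)
    fun φ hφ hc hs => ?_
  have hle : (-1 : ℝ) ≤ 1 := by norm_num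
  rw [integral_partialIntegral_singleton (Finset.empty_subset _) hv hφ hc hs hle ?_]
  · have h1 := h _ (contDiff_segmentIntegral ℓ hle hφ hc)
      (hasCompactSupport_segmentIntegral ℓ (-1) 1 hc)
    rw [← neg_inj, ← h1]
    simp only [Pi.zero_apply, zero_mul, integral_zero, neg_zero]
    refine integral_eq_zero_of_ae ?_
    filter_upwards [ae_mem_unitCube] with t ht
    have h2 : ∀ c : ℝ, t ℓ + c ∉ Ioo (0 : ℝ) 1 → φ (Function.update t ℓ (t ℓ + c)) = 0 := by
      intro c hc'
      refine image_eq_zero_of_notMem_tsupport fun h' => hc' ?_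
      simpa using hs h' ℓ
    rw [partialDeriv_segmentIntegral ℓ hle hφ hc, h2 1 fun h' => by linarith [h'.2, (ht ℓ).1],
      h2 (-1) fun h' => by linarith [h'.1, (ht ℓ).2]]
    simp
  · intro τ hτ s hs1 hne
    simp only [Finset.notMem_empty, false_imp_iff, implies_true, true_iff, mem_Ioc]
    constructor <;> linarith [hτ.1, hτ.2, hs1.1, hs1.2]

end CubePartial

/-! ### The representative as an iterated primitive -/

section Representative

variable {d : ℕ}

/-- `cubePrimitive S T` is `partialIntegral S T` for the uniform distribution on the cube. -/
abbrev cubePrimitive (S T : Finset (Fin d)) (V : (Fin d → ℝ) → ℝ) : (Fin d → ℝ) → ℝ :=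
  partialIntegral (fun _ => volume.restrict (Ioo 0 1)) S T V

/-- The multi-index with entries `1` in `A` and `0` elsewhere. -/
def indicatorIndex (A : Finset (Fin d)) (k : Fin d) : ℕ := if k ∈ A then 1 else 0

theorem indicatorIndex_insert {A : Finset (Fin d)} {ℓ : Fin d} (h : ℓ ∉ A) :
    indicatorIndex (insert ℓ A) = indicatorIndex A + Pi.single ℓ 1 := by
  funext k
  by_cases hk : k = ℓ
  · subst hk; simp [indicatorIndex, h]
  · simp [indicatorIndex, hk]

section Family

variable {α : ℕ} {G : (Fin d → ℕ) → (Fin d → ℝ) → ℝ}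
  (hint : ∀ r, (∀ k, r k ≤ α) → Integrable (G r) (cubeMeasure d))
  (hpart : ∀ r, (∀ k, r k ≤ α) → ∀ ℓ, r ℓ < α → IsCubePartial ℓ (G r) (G (r + Pi.single ℓ 1)))

theorem add_indicatorIndex_le {r : Fin d → ℕ} (hr : ∀ k, r k ≤ α) {A : Finset (Fin d)}
    (hA : ∀ k ∈ A, r k < α) (k : Fin d) : (r + indicatorIndex A) k ≤ α := by
  by_cases h : k ∈ A
  · simpa [indicatorIndex, h] using hA k h
  · simpa [indicatorIndex, h] using hr k

include hint hpart in
-- One direction is added at a time; `partialIntegral_comp` merges the new primitive with the old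
-- ones.
theorem ae_eq_cubePrimitive {r : Fin d → ℕ} (hr : ∀ k, r k ≤ α) (A : Finset (Fin d))
    (hA : ∀ k ∈ A, r k < α) :
    G r =ᵐ[cubeMeasure d] cubePrimitive A A (G (r + indicatorIndex A)) := by
  induction A using Finset.induction_on with
  | empty =>
    rw [cubePrimitive, partialIntegral_empty]
    have : indicatorIndex (∅ : Finset (Fin d)) = 0 := by funext k; simp [indicatorIndex]
    rw [this, add_zero]
  | insert ℓ A hℓ ih =>
    have hA' : ∀ k ∈ A, r k < α := fun k hk => hA k (Finset.mem_insert_of_mem hk)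
    have hle := add_indicatorIndex_le hr hA'
    have hle' := add_indicatorIndex_le hr hA
    have hlt : (r + indicatorIndex A) ℓ < α := by
      simpa [indicatorIndex, hℓ] using hA ℓ (Finset.mem_insert_self _ _)
    rw [indicatorIndex_insert hℓ, ← add_assoc] at hle' ⊢
    refine (ih hA').trans ((partialIntegral_congr_ae A A
      ((hpart _ hle ℓ hlt).ae_eq_partialIntegral (hint _ hle) (hint _ hle'))).trans ?_)
    have := partialIntegral_comp (S := A) (T := A) (S' := {ℓ}) (T' := {ℓ})
      (Finset.disjoint_singleton_right.2 hℓ) subset_rfl subset_rfl (hint _ hle')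
    rwa [Finset.union_singleton] at this

include hint hpart in
-- Integrate first over the full segment in direction ℓ, which gives 0; the primitives in the
-- remaining directions preserve 0.
theorem cubePrimitive_erase_ae_eq_zero {r : Fin d → ℕ} (hr : ∀ k, r k ≤ α) {A : Finset (Fin d)}
    (hA : ∀ k ∈ A, r k < α) {ℓ : Fin d} (hℓ : ℓ ∈ A) :
    cubePrimitive A (A.erase ℓ) (G (r + indicatorIndex A)) =ᵐ[cubeMeasure d] 0 := by
  have hA' : ∀ k ∈ A.erase ℓ, r k < α := fun k hk => hA k (Finset.mem_of_mem_erase hk)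
  have hle := add_indicatorIndex_le hr hA'
  have hle' := add_indicatorIndex_le hr hA
  have hlt : (r + indicatorIndex (A.erase ℓ)) ℓ < α := by
    simpa [indicatorIndex] using hA ℓ hℓ
  have he : r + indicatorIndex A = r + indicatorIndex (A.erase ℓ) + Pi.single ℓ 1 := by
    rw [add_assoc, ← indicatorIndex_insert (Finset.notMem_erase ℓ A), Finset.insert_erase hℓ]
  have h1 := (hpart _ hle ℓ hlt).partialIntegral_ae_eq_zero (he ▸ hint _ hle')
  rw [← he] at h1
  have h2 := partialIntegral_comp (S := A.erase ℓ) (T := A.erase ℓ) (S' := {ℓ}) (T' := ∅)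
    (Finset.disjoint_singleton_right.2 (Finset.notMem_erase ℓ A)) subset_rfl
    (Finset.empty_subset _) (hint _ hle')
  rw [Finset.union_singleton, Finset.insert_erase hℓ, Finset.union_empty] at h2
  refine h2.symm.trans ((partialIntegral_congr_ae _ _ h1).trans ?_)
  refine ae_of_all _ fun x => ?_
  simp [partialIntegral, indicator]

end Family

/-- The fibre through `x` in the directions `S` is regular for `V`: integrability, and the
integrals over full segments vanish. -/
def IsRegularFibre (S : Finset (Fin d)) (V : (Fin d → ℝ) → ℝ) (x : Fin d → ℝ) : Prop :=
  Integrable (fun s => V (S.piecewise s x)) (cubeMeasure d) ∧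
    ∀ ℓ ∈ S, ∀ s ∈ unitCube d, cubePrimitive S (S.erase ℓ) V (S.piecewise s x) = 0

theorem IsRegularFibre.congr {S : Finset (Fin d)} {V : (Fin d → ℝ) → ℝ} {x x' : Fin d → ℝ}
    (h : IsRegularFibre S V x) (hx : ∀ k, k ∉ S → x k = x' k) : IsRegularFibre S V x' := by
  have : ∀ s : Fin d → ℝ, S.piecewise s x = S.piecewise s x' := by
    intro s
    funext k
    by_cases hk : k ∈ S
    · simp [hk]
    · simp [hk, hx k hk]
  unfold IsRegularFibre at h ⊢
  simpa only [this] using h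

/-- On a fibre with integrable `V` the partial integrals are continuous, so vanishing almost
everywhere on the open cube improves to vanishing everywhere there. -/
theorem ae_isRegularFibre {S : Finset (Fin d)} {V : (Fin d → ℝ) → ℝ}
    (hV : Integrable V (cubeMeasure d))
    (h0 : ∀ ℓ ∈ S, cubePrimitive S (S.erase ℓ) V =ᵐ[cubeMeasure d] 0) :
    ∀ᵐ x ∂cubeMeasure d, IsRegularFibre S V x := by
  have h1 : ∀ᵐ x ∂cubeMeasure d, ∀ ℓ ∈ S, ∀ᵐ s ∂cubeMeasure d,
      cubePrimitive S (S.erase ℓ) V (S.piecewise s x) = 0 :=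
    (Finset.eventually_all S).2 fun ℓ hℓ => ae_ae_piecewise S (h0 ℓ hℓ)
  filter_upwards [ae_integrable_piecewise S hV, h1] with x hx hx'
  refine ⟨hx, fun ℓ hℓ => ?_⟩
  have h2 := hx' ℓ hℓ
  rw [← volume_restrict_unitCube] at h2
  exact Measure.eqOn_open_of_ae_eq (f := fun s => cubePrimitive S (S.erase ℓ) V (S.piecewise s x))
    (g := fun _ => 0) h2 isOpen_unitCube (continuous_partialIntegral hx).continuousOn
    continuousOn_const

theorem VanishesAtEnds.of_continuous {G : (Fin d → ℝ) → ℝ} {ℓ : Fin d}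
    {y : {k : Fin d // k ≠ ℓ} → ℝ} (hc : Continuous fun s => G (insertCoord ℓ y s))
    (h0 : G (insertCoord ℓ y 0) = 0) (h1 : G (insertCoord ℓ y 1) = 0) : VanishesAtEnds G ℓ y where
  continuousOn := hc.continuousOn
  tendsto_zero := by
    have := hc.tendsto 0
    rw [h0] at this
    exact this.mono_left nhdsWithin_le_nhds
  tendsto_one := by
    have := hc.tendsto 1
    rw [h1] at this
    exact this.mono_left nhdsWithin_le_nhds
  continuousOn_extension := by
    refine hc.continuousOn.congr fun s hs => ?_
    by_cases h : s ∈ Ioo (0 : ℝ) 1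
    · rw [indicator_of_mem h]
    · rw [indicator_of_notMem h]
      rcases eq_or_lt_of_le hs.1 with h' | h'
      · subst h'; exact h0.symm
      · rcases eq_or_lt_of_le hs.2 with h'' | h''
        · subst h''; exact h1.symm
        · exact absurd ⟨h', h''⟩ h

theorem insertCoord_self (ℓ : Fin d) (y : {k : Fin d // k ≠ ℓ} → ℝ) (s : ℝ) :
    insertCoord ℓ y s ℓ = s := by simp [insertCoord]

theorem insertCoord_of_ne {ℓ k : Fin d} (h : k ≠ ℓ) (y : {k : Fin d // k ≠ ℓ} → ℝ) (s : ℝ) :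
    insertCoord ℓ y s k = y ⟨k, h⟩ := by simp [insertCoord, h]

theorem continuous_insertCoord (ℓ : Fin d) (y : {k : Fin d // k ≠ ℓ} → ℝ) :
    Continuous (insertCoord ℓ y) := by
  refine continuous_pi fun k => ?_
  by_cases h : k = ℓ
  · subst h; simp only [insertCoord_self]; exact continuous_id
  · simp only [insertCoord_of_ne h]; exact continuous_const

theorem ae_coord_mem_Ioo (ℓ : Fin d) : ∀ᵐ s ∂cubeMeasure d, s ℓ ∈ Ioo (0 : ℝ) 1 := by
  filter_upwards [ae_mem_unitCube] with s hs using hs ℓ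

/-- At t_ℓ = 0 the range of integration is null. At t_ℓ = 1 the constraint in direction ℓ is void,
leaving an integral over full segments, which is zero on a regular fibre. The value 2⁻¹ is merely a
base point in (0,1). -/
theorem IsRegularFibre.vanishesAtEnds {S : Finset (Fin d)} {V : (Fin d → ℝ) → ℝ} {ℓ : Fin d}
    (hℓ : ℓ ∈ S) {y : {k : Fin d // k ≠ ℓ} → ℝ} (hy : ∀ k, y k ∈ Ioo (0 : ℝ) 1)
    (h : IsRegularFibre S V (insertCoord ℓ y 2⁻¹)) : VanishesAtEnds (cubePrimitive S S V) ℓ y := by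
  set x := insertCoord ℓ y 2⁻¹ with hx
  have hpw : ∀ σ, S.piecewise (insertCoord ℓ y σ) x = insertCoord ℓ y σ := by
    intro σ
    funext k
    by_cases hk : k ∈ S
    · simp [hk]
    · have : k ≠ ℓ := fun h' => hk (h' ▸ hℓ)
      simp [hk, hx, insertCoord_of_ne this]
  have hS : ∀ s σ σ', S.piecewise s (insertCoord ℓ y σ) = S.piecewise s (insertCoord ℓ y σ') := by
    intro s σ σ'
    funext k
    by_cases hk : k ∈ S
    · simp [hk]
    · have : k ≠ ℓ := fun h' => hk (h' ▸ hℓ)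
      simp [hk, insertCoord_of_ne this]
  refine VanishesAtEnds.of_continuous ?_ ?_ ?_
  · have := (continuous_partialIntegral (T := S) h.1).comp (continuous_insertCoord ℓ y)
    simpa only [Function.comp_def, hpw] using this
  · refine integral_eq_zero_of_ae ?_
    filter_upwards [ae_coord_mem_Ioo ℓ] with s hs
    refine indicator_of_notMem (fun h' => ?_) _
    have := h' ℓ hℓ
    rw [insertCoord_self] at this
    exact absurd this (not_le.2 hs.1)
  · have hxc : x ∈ unitCube d := by
      intro k
      by_cases hk : k = ℓ
      · subst hk; rw [hx, insertCoord_self]; norm_num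
      · rw [hx, insertCoord_of_ne hk]; exact hy _
    have h1 := h.2 ℓ hℓ x hxc
    rw [hpw] at h1
    rw [← h1]
    refine integral_congr_ae ?_
    filter_upwards [ae_coord_mem_Ioo ℓ] with s hs
    have h2 : (∀ k ∈ S, s k ≤ insertCoord ℓ y 1 k) ↔
        ∀ k ∈ S.erase ℓ, s k ≤ insertCoord ℓ y 2⁻¹ k := by
      constructor
      · intro h' k hk
        have := h' k (Finset.mem_of_mem_erase hk)
        rwa [insertCoord_of_ne (Finset.ne_of_mem_erase hk)] at this ⊢
      · intro h' k hk
        by_cases hk' : k = ℓ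
        · subst hk'; rw [insertCoord_self]; exact hs.2.le
        · have := h' k (Finset.mem_erase.2 ⟨hk', hk⟩)
          rwa [insertCoord_of_ne hk'] at this ⊢
    simp only [indicator, mem_ofPred_eq, h2, hS s 1 2⁻¹]

theorem measurePreserving_insertCoord (ℓ : Fin d) :
    MeasurePreserving (fun p : ({k : Fin d // k ≠ ℓ} → ℝ) × ℝ => insertCoord ℓ p.1 p.2)
      ((Measure.pi fun _ => volume.restrict (Ioo 0 1)).prod (volume.restrict (Ioo 0 1)))
      (cubeMeasure d) := by
  have hm : Measurable fun p : ({k : Fin d // k ≠ ℓ} → ℝ) × ℝ => insertCoord ℓ p.1 p.2 := by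
    refine measurable_pi_iff.2 fun k => ?_
    by_cases h : k = ℓ
    · subst h; simp only [insertCoord_self]; fun_prop
    · simp only [insertCoord_of_ne h]; fun_prop
  refine ⟨hm, (Measure.pi_eq fun s hs => ?_).symm⟩
  have hpre : (fun p : ({k : Fin d // k ≠ ℓ} → ℝ) × ℝ => insertCoord ℓ p.1 p.2) ⁻¹' univ.pi s =
      (univ.pi fun k : {k : Fin d // k ≠ ℓ} => s k) ×ˢ s ℓ := by
    ext p
    simp only [mem_preimage, Set.mem_pi, mem_univ, true_imp_iff, mem_prod]
    constructor
    · intro h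
      refine ⟨fun k => ?_, ?_⟩
      · have := h k; rwa [insertCoord_of_ne k.2] at this
      · have := h ℓ; rwa [insertCoord_self] at this
    · rintro ⟨h1, h2⟩ k
      by_cases hk : k = ℓ
      · subst hk; rwa [insertCoord_self]
      · rw [insertCoord_of_ne hk]; exact h1 ⟨k, hk⟩
  rw [Measure.map_apply hm (MeasurableSet.univ_pi hs), hpre, Measure.prod_prod, Measure.pi_pi,
    Fintype.prod_eq_mul_prod_subtype_ne _ ℓ, mul_comm]

/-- Regularity does not depend on the ℓ-th coordinate when ℓ ∈ S, so one good value σ on the line is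
enough. -/
theorem ae_isRegularFibre_insertCoord {S : Finset (Fin d)} {V : (Fin d → ℝ) → ℝ} {ℓ : Fin d}
    (hℓ : ℓ ∈ S) (h : ∀ᵐ x ∂cubeMeasure d, IsRegularFibre S V x) :
    ∀ᵐ y ∂(volume : Measure ({k : Fin d // k ≠ ℓ} → ℝ)), (∀ k, y k ∈ Ioo (0 : ℝ) 1) →
      IsRegularFibre S V (insertCoord ℓ y 2⁻¹) := by
  have h1 := Measure.ae_ae_of_ae_prod
    ((measurePreserving_insertCoord ℓ).quasiMeasurePreserving.ae h)
  rw [← Measure.restrict_pi_pi, ae_restrict_iff' (MeasurableSet.univ_pi fun _ =>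
    measurableSet_Ioo)] at h1
  rw [volume_pi]
  filter_upwards [h1] with y hy hy'
  obtain ⟨σ, hσ⟩ := (hy fun k _ => hy' k).exists
  refine hσ.congr fun k hk => ?_
  have : k ≠ ℓ := fun h' => hk (h' ▸ hℓ)
  rw [insertCoord_of_ne this, insertCoord_of_ne this]

end Representative

/-! ### Application to the Gaussian Sobolev space -/

section GaussSobolev

variable {d : ℕ}

theorem isWeakDeriv_weakDeriv {Ω : Set (Fin d → ℝ)} {r : Fin d → ℕ} {u : (Fin d → ℝ) → ℝ}
    (h : ∃ v, IsWeakDeriv Ω r u v) : IsWeakDeriv Ω r u (weakDeriv Ω r u) := by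
  rw [weakDeriv, dif_pos h]
  exact h.choose_spec

theorem MemGaussSobolev.isWeakDeriv {α : ℕ} {f : (Fin d → ℝ) → ℝ} (hf : MemGaussSobolev α f)
    {s : Fin d → ℕ} (hs : s ∈ multiIndexBox d α) : IsWeakDeriv univ s f (weakDeriv univ s f) :=
  isWeakDeriv_weakDeriv ((hf s (mem_multiIndexBox.1 hs)).imp fun _ h => h.1)

/-- The chosen `weakDeriv` may differ from the square integrable one in the hypothesis, but only on
a null set. -/
theorem MemGaussSobolev.memLp {α : ℕ} {f : (Fin d → ℝ) → ℝ} (hf : MemGaussSobolev α f)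
    {s : Fin d → ℕ} (hs : s ∈ multiIndexBox d α) :
    MemLp (weakDeriv univ s f) 2 (gaussMeasure d) := by
  obtain ⟨v, hv, hv2⟩ := hf s (mem_multiIndexBox.1 hs)
  refine (memLp_congr_ae ?_).1 hv2
  refine (withDensity_absolutelyContinuous volume _) ?_
  filter_upwards [hv.ae_eq isOpen_univ (hf.isWeakDeriv hs)] with x hx using hx (mem_univ x)

theorem add_single_mem_multiIndexBox {α : ℕ} {s : Fin d → ℕ} (hs : ∀ k, s k ≤ α) {ℓ : Fin d}
    (hℓ : s ℓ < α) : ∀ k, (s + Pi.single ℓ 1 : Fin d → ℕ) k ≤ α := by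
  intro k
  by_cases h : k = ℓ
  · subst h; simpa using hℓ
  · simpa [h] using hs k

theorem sum_add_single (s : Fin d → ℕ) (ℓ : Fin d) :
    ∑ k, (s + Pi.single ℓ 1 : Fin d → ℕ) k = (∑ k, s k) + 1 := by
  simp only [Pi.add_apply, Finset.sum_add_distrib, Finset.sum_pi_single', Finset.mem_univ, if_true]

/-- Both sides are, up to the same sign, the integral of f · D^{s+e_ℓ}φ. -/
theorem MemGaussSobolev.isWeakPartial {α : ℕ} {f : (Fin d → ℝ) → ℝ} (hf : MemGaussSobolev α f)
    {s : Fin d → ℕ} (hs : s ∈ multiIndexBox d α) {ℓ : Fin d} (hℓ : s ℓ < α) :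
    IsWeakPartial ℓ (weakDeriv univ s f) (weakDeriv univ (s + Pi.single ℓ 1) f) := by
  intro φ hφ hc
  have h1 := (hf.isWeakDeriv hs).integral_eq _ (hφ.partialDeriv ℓ) (hc.partialDeriv ℓ)
    (subset_univ _)
  have h2 := (hf.isWeakDeriv (mem_multiIndexBox.2 (add_single_mem_multiIndexBox
    (mem_multiIndexBox.1 hs) hℓ))).integral_eq φ hφ hc (subset_univ _)
  rw [iterPartial_add_single hφ, h1, sum_add_single, pow_succ] at h2
  simp only [Measure.restrict_univ] at h2
  have h3 : ((-1 : ℝ) ^ ∑ i, s i) ≠ 0 := pow_ne_zero _ (by norm_num)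
  rw [mul_assoc] at h2
  rw [mul_left_cancel₀ h3 h2]
  ring

theorem MemGaussSobolev.ae_eq_weakDeriv_zero {α : ℕ} {f : (Fin d → ℝ) → ℝ}
    (hf : MemGaussSobolev α f) :
    ∀ᵐ x ∂(volume : Measure (Fin d → ℝ)), f x = weakDeriv univ 0 f x := by
  have h0 : (0 : Fin d → ℕ) ∈ multiIndexBox d α := mem_multiIndexBox.2 fun _ => Nat.zero_le _
  have h := hf.isWeakDeriv h0
  have h' : IsWeakDeriv univ 0 f f :=
    ⟨h.locallyIntegrable_left, h.locallyIntegrable_left, fun φ _ _ _ => by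
      simp [iterPartial_zero]⟩
  filter_upwards [h'.ae_eq isOpen_univ h] with x hx using hx (mem_univ x)

/-- The derivative `D^r` of the transform of `f`. -/
def cotTransformDeriv (α : ℕ) (f : (Fin d → ℝ) → ℝ) (r : Fin d → ℕ) (t : Fin d → ℝ) : ℝ :=
  cotSum α (fun s => weakDeriv univ s f) r (cotMapVec t)

theorem MemGaussSobolev.locallyIntegrable {α : ℕ} {f : (Fin d → ℝ) → ℝ}
    (hf : MemGaussSobolev α f) {s : Fin d → ℕ} (hs : s ∈ multiIndexBox d α) :
    LocallyIntegrable (weakDeriv univ s f) volume :=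
  locallyIntegrableOn_univ.1 (hf.isWeakDeriv hs).locallyIntegrable_right

/-- For r = 0 only s = 0 contributes, and p_{0,0} = π(1 + x²) is φ' expressed in x. -/
theorem cotTransform_ae_eq {α : ℕ} {f : (Fin d → ℝ) → ℝ} (hf : MemGaussSobolev α f) :
    cotTransform f =ᵐ[cubeMeasure d] cotTransformDeriv α f 0 := by
  filter_upwards [ae_cubeMeasure_comp_cotMapVec hf.ae_eq_weakDeriv_zero, ae_mem_unitCube]
    with t ht htc
  have h0 : (0 : Fin d → ℕ) ∈ multiIndexBox d α := mem_multiIndexBox.2 fun _ => Nat.zero_le _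
  rw [cotTransformDeriv, cotSum, Finset.sum_eq_single_of_mem 0 h0, ← ht, cotTransform]
  · have h1 : ∏ k, deriv cotMap (t k) = ∏ k, Real.pi * (1 + cotMapVec t k ^ 2) :=
      Finset.prod_congr rfl fun k _ => deriv_cotMap (htc k)
    rw [h1, gaussDensity_eq_prod, mul_assoc, ← Finset.prod_mul_distrib, mul_comm, cotCoeffVec]
    congr 1
    refine Finset.prod_congr rfl fun k _ => ?_
    simp [cotCoeff, cotPoly, mul_comm]
  · intro s _ hs
    obtain ⟨k, hk⟩ := Function.ne_iff.1 hs
    rw [cotCoeffVec, Finset.prod_eq_zero (Finset.mem_univ k), zero_mul]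
    have : (0 : Fin d → ℕ) k < s k := Nat.pos_of_ne_zero hk
    rw [cotCoeff_eq_zero this]
    rfl

theorem isCubePartial_cotTransformDeriv {α : ℕ} {f : (Fin d → ℝ) → ℝ}
    (hf : MemGaussSobolev α f) {r : Fin d → ℕ} (hr : ∀ k, r k ≤ α) {ℓ : Fin d} (hℓ : r ℓ < α) :
    IsCubePartial ℓ (cotTransformDeriv α f r) (cotTransformDeriv α f (r + Pi.single ℓ 1)) :=
  fun _ hφ hc => integral_cotSum_mul_partialDeriv (fun _ hs => hf.locallyIntegrable hs)
    (fun _ hs => hf.memLp hs) (fun _ hs _ h => hf.isWeakPartial hs h) hr hℓ hφ hc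

theorem eLpNorm_cotTransformDeriv_le {α : ℕ} {B : ℝ} (hB1 : 1 ≤ B)
    (hB : ∀ n ≤ α, ∀ m ≤ α, ∀ x,
      |cotCoeff n m x| ≤ B * (Real.sqrt (gaussDensityOne x) * cauchyWeight x))
    {f : (Fin d → ℝ) → ℝ} (hf : MemGaussSobolev α f) {r : Fin d → ℕ} (hr : ∀ k, r k ≤ α) :
    eLpNorm (cotTransformDeriv α f r) 2 (cubeMeasure d) ≤
      ∑ s ∈ multiIndexBox d α, ENNReal.ofReal (B ^ d) *
        eLpNorm (weakDeriv univ s f) 2 (gaussMeasure d) := by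
  have h1 : eLpNorm (cotTransformDeriv α f r) 2 (cubeMeasure d) =
      eLpNorm (cotSum α (fun s => weakDeriv univ s f) r) 2 (cauchyVecMeasure d) :=
    eLpNorm_comp_cotMapVec _
  have h2 : cotSum α (fun s => weakDeriv univ s f) r =
      ∑ s ∈ multiIndexBox d α, fun x => cotCoeffVec r s x * weakDeriv univ s f x := by
    funext x
    rw [Finset.sum_apply, cotSum]
  rw [h1, h2]
  refine (eLpNorm_sum_le (fun s hs => ?_) one_le_two).trans (Finset.sum_le_sum fun s hs =>
    eLpNorm_cotCoeffVec_mul_le hB1 hB hr (mem_multiIndexBox.1 hs) _)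
  exact ((contDiff_cotCoeffVec r s).continuous.aestronglyMeasurable.mul
    (hf.locallyIntegrable hs).aestronglyMeasurable).mono_ac (withDensity_absolutelyContinuous _ _)

theorem memLp_cotTransformDeriv {α : ℕ} {f : (Fin d → ℝ) → ℝ} (hf : MemGaussSobolev α f)
    {r : Fin d → ℕ} (hr : ∀ k, r k ≤ α) :
    MemLp (cotTransformDeriv α f r) 2 (cubeMeasure d) := by
  obtain ⟨B, hB1, hB⟩ := exists_uniform_bound_cotCoeff α
  refine ⟨aestronglyMeasurable_comp_cotMapVec ?_, ?_⟩
  · refine Finset.aestronglyMeasurable_fun_sum _ fun s hs => ?_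
    exact (contDiff_cotCoeffVec r s).continuous.aestronglyMeasurable.mul
      (hf.locallyIntegrable hs).aestronglyMeasurable
  · refine (eLpNorm_cotTransformDeriv_le hB1 hB hf hr).trans_lt ?_
    exact ENNReal.sum_lt_top.2 fun s hs =>
      ENNReal.mul_lt_top ENNReal.ofReal_lt_top (hf.memLp hs).2

theorem toReal_eLpNorm_weakDeriv_le {α : ℕ} (f : (Fin d → ℝ) → ℝ) {s : Fin d → ℕ}
    (hs : s ∈ multiIndexBox d α) :
    (eLpNorm (weakDeriv univ s f) 2 (gaussMeasure d)).toReal ≤ gaussSobolevNorm α f := by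
  refine Real.le_sqrt_of_sq_le ?_
  exact Finset.single_le_sum (f := fun s : Fin d → ℕ =>
    (eLpNorm (weakDeriv univ s f) 2 (gaussMeasure d)).toReal ^ 2) (fun _ _ => sq_nonneg _) hs

theorem toReal_eLpNorm_cotTransformDeriv_le {α : ℕ} {B : ℝ} (hB1 : 1 ≤ B)
    (hB : ∀ n ≤ α, ∀ m ≤ α, ∀ x,
      |cotCoeff n m x| ≤ B * (Real.sqrt (gaussDensityOne x) * cauchyWeight x))
    {f : (Fin d → ℝ) → ℝ} (hf : MemGaussSobolev α f) {r : Fin d → ℕ} (hr : ∀ k, r k ≤ α) :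
    (eLpNorm (cotTransformDeriv α f r) 2 (cubeMeasure d)).toReal ≤
      (multiIndexBox d α).card * B ^ d * gaussSobolevNorm α f := by
  have hfin : ∀ s ∈ multiIndexBox d α, ENNReal.ofReal (B ^ d) *
      eLpNorm (weakDeriv univ s f) 2 (gaussMeasure d) ≠ ⊤ := fun s hs =>
    (ENNReal.mul_lt_top ENNReal.ofReal_lt_top (hf.memLp hs).2).ne
  refine (ENNReal.toReal_mono (ENNReal.sum_ne_top.2 hfin)
    (eLpNorm_cotTransformDeriv_le hB1 hB hf hr)).trans ?_
  rw [ENNReal.toReal_sum hfin, mul_assoc, ← nsmul_eq_mul]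
  refine Finset.sum_le_card_nsmul _ _ _ fun s hs => ?_
  rw [ENNReal.toReal_mul, ENNReal.toReal_ofReal (by positivity)]
  exact mul_le_mul_of_nonneg_left (toReal_eLpNorm_weakDeriv_le f hs) (by positivity)

/-- Induction on |r|, moving one derivative at a time off the test function; again φ may be nonzero
on the boundary. -/
theorem integral_cotTransform_mul_iterPartial {α : ℕ} {f : (Fin d → ℝ) → ℝ}
    (hf : MemGaussSobolev α f) (n : ℕ) :
    ∀ r : Fin d → ℕ, (∀ k, r k ≤ α) → ∑ k, r k = n → ∀ φ : (Fin d → ℝ) → ℝ, ContDiff ℝ ∞ φ →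
      HasCompactSupport φ → ∫ t, cotTransformDeriv α f 0 t * iterPartial r φ t ∂cubeMeasure d =
        (-1) ^ n * ∫ t, cotTransformDeriv α f r t * φ t ∂cubeMeasure d := by
  induction n with
  | zero =>
    intro r _ hn φ _ _
    have : r = 0 := funext fun k => Finset.sum_eq_zero_iff.1 hn k (Finset.mem_univ k)
    subst this
    simp [iterPartial_zero]
  | succ n ih =>
    intro r hr hn φ hφ hc
    obtain ⟨ℓ, hℓ⟩ : ∃ ℓ, r ℓ ≠ 0 := by
      by_contra! h
      simp [h] at hn
    obtain ⟨q, rfl⟩ : ∃ q : Fin d → ℕ, r = q + Pi.single ℓ 1 := by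
      refine ⟨r - Pi.single ℓ 1, (tsub_add_cancel_of_le fun k => ?_).symm⟩
      by_cases h : k = ℓ
      · subst h; simpa using Nat.one_le_iff_ne_zero.2 hℓ
      · simp [h]
    have hq : ∀ k, q k ≤ α := fun k => le_trans (by simp) (hr k)
    have hqℓ : q ℓ < α := by simpa using hr ℓ
    rw [sum_add_single, add_left_inj] at hn
    rw [iterPartial_add_single hφ, ih q hq hn _ (hφ.partialDeriv ℓ) (hc.partialDeriv ℓ),
      isCubePartial_cotTransformDeriv hf hq hqℓ φ hφ hc, pow_succ]
    ring

theorem isWeakDeriv_cotTransform {α : ℕ} {f : (Fin d → ℝ) → ℝ} (hf : MemGaussSobolev α f)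
    {r : Fin d → ℕ} (hr : ∀ k, r k ≤ α) {G : (Fin d → ℝ) → ℝ}
    (hG : G =ᵐ[cubeMeasure d] cotTransformDeriv α f r) :
    IsWeakDeriv (unitCube d) r (cotTransform f) G := by
  have hloc : ∀ (q : Fin d → ℕ), (∀ k, q k ≤ α) → ∀ u : (Fin d → ℝ) → ℝ,
      u =ᵐ[cubeMeasure d] cotTransformDeriv α f q → LocallyIntegrableOn u (unitCube d) volume := by
    intro q hq u hu
    have h := ((memLp_cotTransformDeriv hf hq).integrable one_le_two).congr hu.symm
    rw [← volume_restrict_unitCube] at h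
    exact IntegrableOn.locallyIntegrableOn h
  refine ⟨hloc 0 (fun _ => Nat.zero_le _) _ (cotTransform_ae_eq hf), hloc r hr G hG, ?_⟩
  intro φ hφ hc _
  rw [volume_restrict_unitCube]
  have h1 : ∫ t, cotTransform f t * iterPartial r φ t ∂cubeMeasure d =
      ∫ t, cotTransformDeriv α f 0 t * iterPartial r φ t ∂cubeMeasure d := by
    refine integral_congr_ae ?_
    filter_upwards [cotTransform_ae_eq hf] with t ht
    rw [ht]
  have h2 : ∫ t, G t * φ t ∂cubeMeasure d =
      ∫ t, cotTransformDeriv α f r t * φ t ∂cubeMeasure d := by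
    refine integral_congr_ae ?_
    filter_upwards [hG] with t ht
    rw [ht]
  rw [h1, h2]
  exact integral_cotTransform_mul_iterPartial hf _ r hr rfl φ hφ hc

end GaussSobolev
end

theorem mainTheorem8 (d α : ℕ) (hd : 1 ≤ d) (hα : 1 ≤ α) :
    ∃ C : ℝ, 0 < C ∧ ∀ f : (Fin d → ℝ) → ℝ, MemGaussSobolev α f →
      ∀ r : Fin d → ℕ, (∀ k, r k ≤ α) →
        ∃ G : (Fin d → ℝ) → ℝ,
          IsWeakDeriv (unitCube d) r (cotTransform f) G ∧
          MemLp G 2 (volume.restrict (unitCube d)) ∧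
          (eLpNorm G 2 (volume.restrict (unitCube d))).toReal ≤ C * gaussSobolevNorm α f ∧
          (∀ ℓ : Fin d, r ℓ ≤ α - 1 →
            ∀ᵐ y ∂(volume : Measure ({k : Fin d // k ≠ ℓ} → ℝ)),
              (∀ k, y k ∈ Ioo (0 : ℝ) 1) → VanishesAtEnds G ℓ y) ∧
          ((∀ k, r k ≤ α - 1) →
            ContinuousOn G (unitCube d) ∧
            ∀ ℓ : Fin d, ∀ y : {k : Fin d // k ≠ ℓ} → ℝ,
              (∀ k, y k ∈ Ioo (0 : ℝ) 1) → VanishesAtEnds G ℓ y) := by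
  obtain ⟨B, hB1, hB⟩ := exists_uniform_bound_cotCoeff α
  have hcard : 0 < (multiIndexBox d α).card :=
    Finset.card_pos.2 ⟨0, mem_multiIndexBox.2 fun _ => Nat.zero_le _⟩
  -- One factor Bᵈ for each multi-index in the sum; `B` depends only on α.
  refine ⟨(multiIndexBox d α).card * B ^ d, by positivity, fun f hf r hr => ?_⟩
  -- All directions in which one more derivative is available.
  set S : Finset (Fin d) := Finset.univ.filter fun k => r k < α with hS
  have hSlt : ∀ k ∈ S, r k < α := fun k hk => (Finset.mem_filter.1 hk).2
  -- Natural subtraction: 1 ≤ α is what makes r_k ≤ α - 1 give r_k < α.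
  have hmem : ∀ k, r k ≤ α - 1 → k ∈ S := fun k hk =>
    Finset.mem_filter.2 ⟨Finset.mem_univ k, by omega⟩
  have hint : ∀ r : Fin d → ℕ, (∀ k, r k ≤ α) →
      Integrable (cotTransformDeriv α f r) (cubeMeasure d) := fun r hr =>
    (memLp_cotTransformDeriv hf hr).integrable one_le_two
  have hpart : ∀ r : Fin d → ℕ, (∀ k, r k ≤ α) → ∀ ℓ, r ℓ < α →
      IsCubePartial ℓ (cotTransformDeriv α f r) (cotTransformDeriv α f (r + Pi.single ℓ 1)) :=
    fun r hr ℓ hℓ => isCubePartial_cotTransformDeriv hf hr hℓ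
  set V := cotTransformDeriv α f (r + indicatorIndex S) with hV
  have hG : cubePrimitive S S V =ᵐ[cubeMeasure d] cotTransformDeriv α f r :=
    (ae_eq_cubePrimitive hint hpart hr S hSlt).symm
  have hreg : ∀ᵐ x ∂cubeMeasure d, IsRegularFibre S V x :=
    ae_isRegularFibre (hint _ (add_indicatorIndex_le hr hSlt)) fun ℓ hℓ =>
      cubePrimitive_erase_ae_eq_zero hint hpart hr hSlt hℓ
  refine ⟨cubePrimitive S S V, isWeakDeriv_cotTransform hf hr hG, ?_, ?_, ?_, ?_⟩
  · rw [volume_restrict_unitCube]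
    exact (memLp_congr_ae hG).2 (memLp_cotTransformDeriv hf hr)
  · rw [volume_restrict_unitCube, eLpNorm_congr_ae hG]
    exact toReal_eLpNorm_cotTransformDeriv_le hB1 hB hf hr
  · intro ℓ hℓ
    filter_upwards [ae_isRegularFibre_insertCoord (hmem ℓ hℓ) hreg] with y hy hy'
    exact (hy hy').vanishesAtEnds (hmem ℓ hℓ) hy'
  · intro hr1
    have hall : ∀ k, k ∈ S := fun k => hmem k (hr1 k)
    have hSu : S = Finset.univ := Finset.eq_univ_iff_forall.2 hall
    -- With every direction in `S` the whole space is one fibre, so a single regular point makes all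
    -- points regular.
    obtain ⟨x, hx⟩ := hreg.exists
    have hx' : ∀ x', IsRegularFibre S V x' := fun x' =>
      hx.congr fun k hk => absurd (hall k) hk
    refine ⟨?_, fun ℓ y hy => (hx' _).vanishesAtEnds (hall ℓ) hy⟩
    have hpw : ∀ z : Fin d → ℝ, S.piecewise z x = z := fun z =>
      funext fun k => Finset.piecewise_eq_of_mem _ _ _ (hall k)
    have := continuous_partialIntegral (T := S) hx.1
    simp only [hpw] at this
    exact this.continuousOn
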